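/- Let $\mathbb{Q}[[x_1,x_2,\ldots]]$ be the ring of formal power series in countably many variables, with the topology of coefficientwise convergence ($\mathbb{Q}$ discrete). For a composition $\alpha=[\alpha_1,\ldots,\alpha_k]$ of an integer $d>0$ put $D(\alpha)=\{\alpha_1,\alpha_1+\alpha_2,\ldots,\alpha_1+\cdots+\alpha_{k-1}\}$ and let $$F_\alpha=\sum_{\substack{1\le j_1\le j_2\le\cdots\le j_d\\ s\in D(\alpha)\Rightarrow j_s<j_{s+1}}}x_{j_1}x_{j_2}\cdots x_{j_d}$$ be the fundamental quasi-symmetric function. For an integer $e\ge 0$ let $\mathcal{J}^{(e)}$ be the ideal of $\mathbb{Q}[[x_1,x_2,\ldots]]$ generated by those $F_\alpha$ ($\alpha$ a composition of a positive integer) for which some (possibly empty) initial factor $\pi$ of $\alpha$ satisfies $d(\pi)-\ell(\pi)\ge e$, where $d(\pi)$ is the sum and $\ell(\pi)$ the number of the parts of $\pi$. Let $R^{(e)}$ be the quotient of $\mathbb{Q}[[x_1,x_2,\ldots]]$ by the closure $\overline{\mathcal{J}^{(e)}}$, with the quotient topology. To a monomial $X^a=x_1^{a_1}x_2^{a_2}\cdots$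 of finite degree associate the lattice path $(0,0)\to(a_1,0)\to(a_1,1)\to(a_1+a_2,1)\to(a_1+a_2,2)\to\cdots$; call $a$ of type $e$-Catalan if every point $(x,y)$ of this path satisfies $x-y\le e$. Then for every integer $e\ge 0$ the classes of the monomials $X^a$ with $a$ of type $e$-Catalan form a Hilbert basis of $R^{(e)}$: every element of $R^{(e)}$ is in exactly one way the sum of a convergent, possibly infinite, series $\sum_a c_a X^a$ over the $a$ of type $e$-Catalan, with coefficients $c_a\in\mathbb{Q}$. Moreover $\mathcal{J}^{(0)}$ is the ideal $\mathcal{J}$ generated by the $F_\alpha$ for all compositions $\alpha$ of positive integers (the non-constant quasi-symmetric functions), so that the case $e=0$ describes the quotient by $\overline{\mathcal{J}}$ in terms of Catalan paths. -/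

import Mathlib

/-- The ring `ℚ⟦x₁, x₂, x₃, …⟧` of formal power series in countably many variables; the index
`i : ℕ` stands for the variable `x_{i+1}`. -/
abbrev QSeries : Type := MvPowerSeries ℕ ℚ

/-- The standard topology on formal power series: coefficientwise convergence, with the discrete
topology on the field of coefficients. -/
instance QSeries.topologicalSpace : TopologicalSpace QSeries :=
  @MvPowerSeries.WithPiTopology.instTopologicalSpace ℕ ℚ ⊥

instance QSeries.isTopologicalRing : IsTopologicalRing QSeries :=
  letI : TopologicalSpace ℚ := ⊥
  haveI : DiscreteTopology ℚ := ⟨rfl⟩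
  MvPowerSeries.WithPiTopology.instIsTopologicalRing ℕ ℚ

/-- The subset `D(α) = {α₁, α₁ + α₂, …, α₁ + ⋯ + α_{k-1}}` of `{1, …, d - 1}` that corresponds to
the composition `α = [α₁, …, α_k]` of `d`. -/
def partialSumSet {d : ℕ} (α : Composition d) : Set ℕ :=
  {s | ∃ i, 0 < i ∧ i < α.length ∧ s = α.sizeUpTo i}

/-- The weakly increasing index sequences `j₁ ≤ j₂ ≤ ⋯ ≤ j_d` with `j_s < j_{s+1}` for every
`s ∈ D(α)`. Entries are numbered from `0`, so `j_s` is the entry at `p = s - 1` and `j_{s+1}` is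
the entry at `q = s`. -/
def fundamentalIndices {d : ℕ} (α : Composition d) : Set (Fin d → ℕ) :=
  {j | Monotone j ∧
    ∀ p q : Fin d, (p : ℕ) + 1 = q → (q : ℕ) ∈ partialSumSet α → j p < j q}

/-- The fundamental quasi-symmetric function `F_α = ∑ x_{j₁} x_{j₂} ⋯ x_{j_d}`, the sum over the
sequences in `fundamentalIndices α`: the coefficient of a monomial is the number of sequences that
yield this monomial. -/
noncomputable def fundamentalQSym {d : ℕ} (α : Composition d) : QSeries :=
  fun m => (({j ∈ fundamentalIndices α | ∑ p, Finsupp.single (j p) 1 = m}.ncard : ℕ) : ℚ)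

/-- Some initial factor `π` of `α` satisfies `d(π) - ℓ(π) ≥ e`. -/
def ReachesLevel (e : ℕ) {d : ℕ} (α : Composition d) : Prop :=
  ∃ π ρ : List ℕ, α.blocks = π ++ ρ ∧ (e : ℤ) ≤ (π.sum : ℤ) - (π.length : ℤ)

/-- The ideal `𝒥` generated by the non-constant quasi-symmetric functions. -/
noncomputable def qsymIdeal : Ideal QSeries :=
  Ideal.span {f | ∃ (d : ℕ) (α : Composition d), 0 < d ∧ f = fundamentalQSym α}

/-- The ideal `𝒥^(e)`, generated by the `F_α` (`α` a composition of a positive integer) for which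
some initial factor `π` of `α` has `d(π) - ℓ(π) ≥ e`. -/
noncomputable def levelIdeal (e : ℕ) : Ideal QSeries :=
  Ideal.span {f | ∃ (d : ℕ) (α : Composition d),
    0 < d ∧ ReachesLevel e α ∧ f = fundamentalQSym α}

/-- The quotient `R^(e)` of `ℚ⟦x₁, x₂, …⟧` by the closure of `𝒥^(e)`; it carries the quotient
topology. -/
abbrev LevelQuotient (e : ℕ) : Type := QSeries ⧸ (levelIdeal e).closure

/-- The lattice points of the north-east path of the exponent sequence `a` of a monomial:
`(0,0) → (a₁,0) → (a₁,1) → (a₁+a₂,1) → (a₁+a₂,2) → ⋯`. At height `y` it occupies the abscissas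
from `a₁ + ⋯ + a_y` to `a₁ + ⋯ + a_{y+1}`. -/
def pathPoints (a : ℕ →₀ ℕ) : Set (ℕ × ℕ) :=
  {P | ∑ i ∈ Finset.range P.2, a i ≤ P.1 ∧ P.1 ≤ ∑ i ∈ Finset.range (P.2 + 1), a i}

/-- `a` is of type `e`-Catalan: its path remains (weakly) above the line `y = x - e`. -/
def IsECatalan (e : ℕ) (a : ℕ →₀ ℕ) : Prop :=
  ∀ P ∈ pathPoints a, (P.1 : ℤ) - (P.2 : ℤ) ≤ (e : ℤ)

/-- A family `b` in a topological `ℚ`-vector space is a Hilbert basis if every vector is in exactly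
one way the sum of a (possibly infinite) convergent series `∑ cᵢ bᵢ`, `cᵢ ∈ ℚ`. -/
def IsHilbertBasis {ι V : Type*} [AddCommGroup V] [Module ℚ V] [TopologicalSpace V]
    (b : ι → V) : Prop :=
  ∀ v : V, ∃! c : ι → ℚ, HasSum (fun i => c i • b i) v

/-!
A composition is encoded by the list `l` of its parts, each lowered by one; then `d(π) - ℓ(π)` is
the sum of the encoding list, it is largest for the whole composition, and the ideal `𝒥^(e)` is
generated by the `F_l` with `l ≠ []` and `e ≤ l.sum` (`levelIdeal_eq_span`). Let `σ` be the shift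
`f(x₁, x₂, …) ↦ f(x₂, x₃, …)`. Splitting off the first variable gives
`F_{a+1,l} = σ F_{a+1,l} + x₁ F_{a,l}` and `F_{0,l} = σ F_{0,l} + x₁ σ F_l`, and everything rests on
these two identities.

*Every class is a series in Catalan monomials.* By the identities, `σ` maps `𝒥^(e+1)` to `𝒥^(e)`,
and every `f ∈ 𝒥^(e-a)` gives an element `x₁^{a+1} σ f + (lower degree in x₁)` of `𝒥^(e)`. By
induction along the path, every monomial that is not `e`-Catalan is the lexicographically leading
monomial of an element of `𝒥^(e)` (`exists_hasLeading_mem_levelIdeal`). Hence a finitely supported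
functional that vanishes on `𝒥^(e)` is determined by its `e`-Catalan coordinates, and by linear
duality every series is an `e`-Catalan series plus an element of the closure
(`exists_sub_mem_closure`).

*The coefficients are unique.* The shift reduces this to `e = 0`. For `n` variables, the exponent
sequences `c` of type `0`-Catalan correspond to noncrossing partitions of `{0, …, n - 1}`. Let the
point of `c` have as `i`-th coordinate the predecessor `z_i` of `i` in the cyclic order of its
block. These points are distinct, and the word `z₀ 0⁻¹ z₁ 1⁻¹ ⋯ z_{n-1} (n-1)⁻¹` is trivial in the
free group (`pairWord_cyclePairs`, `eq_of_cyclePairs_eq`). Adding a variable to the value functions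
`l ↦ F_l(x)` is an invertible operation, and removing a constant changes only terms of lower degree.
As adding all `z_i` and removing all `i`, in alternation, does nothing, each nonconstant `F_l`
coincides on the points with a polynomial of degree less than `deg F_l`
(`componentValue_mem_degreeFiltration`). Together with the first part, this shows that the Catalan
monomials span the functions on the points; there are equally many of both, so they are linearly
independent there (`linearIndependent_catalanValue`). The homogeneous component of degree `d` of a
Catalan series in the closure of the ideal agrees on the points with a combination of Catalan
monomials of degree less than `d`, so it vanishes.
-/

/-! ### Shifting the variables -/

/-- The exponent sequence `(m₁, m₂, …)` of the variables other than the first one. -/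
noncomputable def tailExp (m : ℕ →₀ ℕ) : ℕ →₀ ℕ :=
  m.comapDomain Nat.succ Nat.succ_injective.injOn

/-- The successor function, as an embedding. -/
def succEmb : ℕ ↪ ℕ := ⟨Nat.succ, Nat.succ_injective⟩

/-- The partial sum `m₀ + ⋯ + m_{k-1}` of an exponent sequence. -/
def partialSum (m : ℕ →₀ ℕ) (k : ℕ) : ℕ := ∑ i ∈ Finset.range k, m i

@[simp] lemma tailExp_apply (m : ℕ →₀ ℕ) (i : ℕ) : tailExp m i = m (i + 1) := rfl

lemma embDomain_succ_zero (m : ℕ →₀ ℕ) : m.embDomain succEmb 0 = 0 :=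
  Finsupp.embDomain_of_notMem_range _ _ _ (by rintro ⟨i, hi⟩; exact Nat.succ_ne_zero i hi)

lemma embDomain_succ_succ (m : ℕ →₀ ℕ) (i : ℕ) : m.embDomain succEmb (i + 1) = m i :=
  Finsupp.embDomain_apply_self succEmb m i

@[simp] lemma tailExp_embDomain (m : ℕ →₀ ℕ) : tailExp (m.embDomain succEmb) = m := by
  ext i; simp [embDomain_succ_succ]

lemma single_add_embDomain_tailExp (m : ℕ →₀ ℕ) :
    Finsupp.single 0 (m 0) + (tailExp m).embDomain succEmb = m := by
  ext i
  cases i with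
  | zero => simp [embDomain_succ_zero]
  | succ i => simp [embDomain_succ_succ]

lemma embDomain_tailExp {m : ℕ →₀ ℕ} (h : m 0 = 0) : (tailExp m).embDomain succEmb = m := by
  conv_rhs => rw [← single_add_embDomain_tailExp m, h]
  simp

lemma degree_eq_add_tailExp (m : ℕ →₀ ℕ) : m.degree = m 0 + (tailExp m).degree := by
  conv_lhs => rw [← single_add_embDomain_tailExp m]
  rw [map_add, Finsupp.degree_single]
  congr 1
  simp [Finsupp.degree_apply, Finsupp.embDomain_apply_self]

@[simp] lemma partialSum_zero (m : ℕ →₀ ℕ) : partialSum m 0 = 0 := rfl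

lemma partialSum_succ (m : ℕ →₀ ℕ) (k : ℕ) : partialSum m (k + 1) = partialSum m k + m k :=
  Finset.sum_range_succ _ _

lemma partialSum_succ' (m : ℕ →₀ ℕ) (k : ℕ) :
    partialSum m (k + 1) = m 0 + partialSum (tailExp m) k := by
  rw [partialSum, Finset.sum_range_succ', add_comm]; rfl

lemma partialSum_mono (m : ℕ →₀ ℕ) : Monotone (partialSum m) :=
  monotone_nat_of_le_succ fun k => by rw [partialSum_succ]; omega

lemma partialSum_le_degree (m : ℕ →₀ ℕ) (k : ℕ) : partialSum m k ≤ m.degree := by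
  induction k generalizing m with
  | zero => simp
  | succ k ih => rw [partialSum_succ', degree_eq_add_tailExp]; have := ih (tailExp m); omega

lemma exists_partialSum_eq_degree (m : ℕ →₀ ℕ) : ∃ k, partialSum m k = m.degree := by
  refine ⟨m.support.sup id + 1, ?_⟩
  rw [partialSum, Finsupp.degree_apply]
  symm
  refine Finset.sum_subset (fun i hi => ?_) (fun i _ hi => by simpa using hi)
  have : id i ≤ m.support.sup id := Finset.le_sup hi
  simpa [Nat.lt_succ_iff] using this

/-- The shift `f(x₁, x₂, …) ↦ f(x₂, x₃, …)`. -/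
noncomputable def shiftSeries : QSeries →ₐ[ℚ] QSeries := MvPowerSeries.rename succEmb

lemma coeff_shiftSeries (f : QSeries) (m : ℕ →₀ ℕ) :
    MvPowerSeries.coeff m (shiftSeries f) =
      if m 0 = 0 then MvPowerSeries.coeff (tailExp m) f else 0 := by
  split_ifs with h
  · conv_lhs => rw [← embDomain_tailExp h]
    exact MvPowerSeries.coeff_embDomain_rename succEmb f _
  · refine MvPowerSeries.coeff_rename_eq_zero _ _ ?_
    rintro ⟨m', rfl⟩
    rw [← Finsupp.embDomain_eq_mapDomain] at h
    exact h (embDomain_succ_zero m')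

lemma coeff_X_zero_mul (f : QSeries) (m : ℕ →₀ ℕ) :
    MvPowerSeries.coeff m (MvPowerSeries.X 0 * f) =
      if 1 ≤ m 0 then MvPowerSeries.coeff (m - Finsupp.single 0 1) f else 0 := by
  rw [MvPowerSeries.X, MvPowerSeries.coeff_monomial_mul]
  simp [Finsupp.single_le_iff]

/-! ### Fundamental quasi-symmetric functions indexed by lists -/

/-- The parts `l₁ + 1, l₂ + 1, …` of the composition encoded by the list `l`. All lists of natural
numbers encode compositions in this way, and `l.sum` is the sum of the parts minus their number. -/
def parts (l : List ℕ) : List ℕ := l.map (· + 1)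

@[simp] lemma parts_nil : parts [] = [] := rfl

@[simp] lemma parts_cons (a : ℕ) (l : List ℕ) : parts (a :: l) = (a + 1) :: parts l := rfl

/-- The monomial `m` occurs in the fundamental quasi-symmetric function of `parts l`: the degrees
agree, and all partial sums of the composition are partial sums of `m`. -/
def Occurs (l : List ℕ) (m : ℕ →₀ ℕ) : Prop :=
  m.degree = (parts l).sum ∧ ∀ p, p <+: l → (parts p).sum ∈ Set.range (partialSum m)

open Classical in
/-- The fundamental quasi-symmetric function of the composition `parts l`. -/
noncomputable def listFundamental (l : List ℕ) : QSeries :=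
  fun m => if Occurs l m then 1 else 0

open Classical in
lemma coeff_listFundamental (l : List ℕ) (m : ℕ →₀ ℕ) :
    MvPowerSeries.coeff m (listFundamental l) = if Occurs l m then 1 else 0 := rfl

lemma occurs_nil (m : ℕ →₀ ℕ) : Occurs [] m ↔ m = 0 := by
  simp only [Occurs, parts_nil, List.sum_nil, Finsupp.degree_eq_zero_iff, List.prefix_nil,
    forall_eq, and_iff_left_iff_imp]
  exact fun _ => ⟨0, rfl⟩

lemma listFundamental_nil : listFundamental [] = 1 := by
  classical
  ext m
  rw [coeff_listFundamental, MvPowerSeries.coeff_one]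
  simp [occurs_nil]

lemma occurs_tailExp {l : List ℕ} {m : ℕ →₀ ℕ} (h : m 0 = 0) :
    Occurs l m ↔ Occurs l (tailExp m) := by
  have : Set.range (partialSum m) = Set.range (partialSum (tailExp m)) := by
    ext s
    constructor
    · rintro ⟨k, rfl⟩
      cases k with
      | zero => exact ⟨0, rfl⟩
      | succ k => exact ⟨k, by rw [partialSum_succ', h, zero_add]⟩
    · rintro ⟨k, rfl⟩
      exact ⟨k + 1, by rw [partialSum_succ', h, zero_add]⟩
  rw [Occurs, Occurs, this, degree_eq_add_tailExp, h, zero_add]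

lemma partialSum_sub_single {m : ℕ →₀ ℕ} (h : 1 ≤ m 0) (k : ℕ) :
    partialSum m (k + 1) = partialSum (m - Finsupp.single 0 1) (k + 1) + 1 := by
  have : tailExp (m - Finsupp.single 0 1) = tailExp m := by ext i; simp
  rw [partialSum_succ', partialSum_succ', this]
  simp only [Finsupp.coe_tsub, Pi.sub_apply, Finsupp.single_eq_same]
  omega

lemma degree_sub_single {m : ℕ →₀ ℕ} (h : 1 ≤ m 0) :
    m.degree = (m - Finsupp.single 0 1).degree + 1 := by
  have : tailExp (m - Finsupp.single 0 1) = tailExp m := by ext i; simp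
  rw [degree_eq_add_tailExp, degree_eq_add_tailExp (m - _), this]
  simp only [Finsupp.coe_tsub, Pi.sub_apply, Finsupp.single_eq_same]
  omega

lemma forall_prefix_cons {P : List ℕ → Prop} (a : ℕ) (l : List ℕ) :
    (∀ p, p <+: a :: l → P p) ↔ P [] ∧ ∀ p, p <+: l → P (a :: p) := by
  constructor
  · exact fun h => ⟨h _ (List.nil_prefix), fun p hp => h _ (List.cons_prefix_cons.2 ⟨rfl, hp⟩)⟩
  · rintro ⟨h0, h1⟩ p hp
    rcases List.prefix_cons_iff.1 hp with rfl | ⟨t, rfl, ht⟩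
    · exact h0
    · exact h1 t ht

lemma zero_mem_range_partialSum (m : ℕ →₀ ℕ) : 0 ∈ Set.range (partialSum m) := ⟨0, rfl⟩

lemma occurs_succ_cons {a : ℕ} {l : List ℕ} {m : ℕ →₀ ℕ} (h : 1 ≤ m 0) :
    Occurs ((a + 1) :: l) m ↔ Occurs (a :: l) (m - Finsupp.single 0 1) := by
  rw [Occurs, Occurs, degree_sub_single h]
  simp only [forall_prefix_cons, parts_nil, parts_cons, List.sum_nil, List.sum_cons,
    zero_mem_range_partialSum, true_and]
  refine and_congr (by omega) (forall₂_congr fun p _ => ?_)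
  constructor
  · rintro ⟨k, hk⟩
    cases k with
    | zero => simp at hk; omega
    | succ k => exact ⟨k + 1, by rw [partialSum_sub_single h] at hk; omega⟩
  · rintro ⟨k, hk⟩
    cases k with
    | zero => simp at hk; omega
    | succ k => exact ⟨k + 1, by rw [partialSum_sub_single h]; omega⟩

lemma occurs_zero_cons {l : List ℕ} {m : ℕ →₀ ℕ} (h : 1 ≤ m 0) :
    Occurs (0 :: l) m ↔ (m - Finsupp.single 0 1 : ℕ →₀ ℕ) 0 = 0 ∧
      Occurs l (tailExp (m - Finsupp.single 0 1)) := by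
  have ht : tailExp (m - Finsupp.single 0 1) = tailExp m := by ext i; simp
  have h0 : (m - Finsupp.single 0 1 : ℕ →₀ ℕ) 0 = m 0 - 1 := by simp
  rw [Occurs, Occurs, ht, h0, degree_eq_add_tailExp]
  simp only [forall_prefix_cons, parts_nil, parts_cons, List.sum_nil, List.sum_cons,
    zero_mem_range_partialSum, true_and]
  constructor
  · rintro ⟨hd, hp⟩
    have hm : m 0 = 1 := by
      obtain ⟨k, hk⟩ := hp [] List.nil_prefix
      cases k with
      | zero => simp at hk
      | succ k => rw [partialSum_succ'] at hk; simp at hk; omega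
    refine ⟨by omega, by omega, fun p hpl => ?_⟩
    obtain ⟨k, hk⟩ := hp p hpl
    cases k with
    | zero => simp at hk; omega
    | succ k => exact ⟨k, by rw [partialSum_succ'] at hk; omega⟩
  · rintro ⟨hm, hd, hp⟩
    refine ⟨by omega, fun p hpl => ?_⟩
    obtain ⟨k, hk⟩ := hp p hpl
    exact ⟨k + 1, by rw [partialSum_succ']; omega⟩

/-- Splitting off the first variable when the first part is at least `2`. -/
lemma listFundamental_succ_cons (a : ℕ) (l : List ℕ) :
    listFundamental ((a + 1) :: l) =
      shiftSeries (listFundamental ((a + 1) :: l)) +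
        MvPowerSeries.X 0 * listFundamental (a :: l) := by
  classical
  ext m
  rw [map_add, coeff_shiftSeries, coeff_X_zero_mul]
  simp only [coeff_listFundamental]
  rcases Nat.eq_zero_or_pos (m 0) with h | h
  · simp [h, occurs_tailExp h]
  · have h' : 1 ≤ m 0 := h
    simp [h.ne', h', occurs_succ_cons h']

/-- Splitting off the first variable when the first part is `1`. -/
lemma listFundamental_zero_cons (l : List ℕ) :
    listFundamental (0 :: l) =
      shiftSeries (listFundamental (0 :: l)) +
        MvPowerSeries.X 0 * shiftSeries (listFundamental l) := by
  classical
  ext m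
  rw [map_add, coeff_shiftSeries, coeff_X_zero_mul, coeff_shiftSeries]
  simp only [coeff_listFundamental]
  rcases Nat.eq_zero_or_pos (m 0) with h | h
  · simp [h, occurs_tailExp h]
  · have h' : 1 ≤ m 0 := h
    rw [occurs_zero_cons h']
    by_cases h1 : m 0 - 1 = 0 <;> simp [h.ne', h', h1]

/-! ### Comparison with the index sequences -/

lemma sum_single_apply {d : ℕ} (j : Fin d → ℕ) (i : ℕ) :
    (∑ p, Finsupp.single (j p) 1 : ℕ →₀ ℕ) i = (Finset.univ.filter fun p => j p = i).card := by
  rw [Finsupp.finsetSum_apply, Finset.card_filter]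
  exact Finset.sum_congr rfl fun p _ => by rw [Finsupp.single_apply]

lemma partialSum_sum_single {d : ℕ} (j : Fin d → ℕ) (k : ℕ) :
    partialSum (∑ p, Finsupp.single (j p) 1) k =
      (Finset.univ.filter fun p => j p < k).card := by
  induction k with
  | zero => simp
  | succ k ih =>
    rw [partialSum_succ, ih, sum_single_apply, ← Finset.card_union_of_disjoint]
    · congr 1; ext p; simp; omega
    · refine Finset.disjoint_filter.2 fun p _ h => by omega

/-- A weakly increasing sequence is determined by its monomial `m`: the entry at `p` is smaller
than `k` exactly if `p` is smaller than the `k`-th partial sum of `m`. -/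
lemma lt_iff_of_sum_single {d : ℕ} {j : Fin d → ℕ} (hj : Monotone j) {m : ℕ →₀ ℕ}
    (hm : ∑ p, Finsupp.single (j p) 1 = m) (p : Fin d) (k : ℕ) :
    j p < k ↔ (p : ℕ) < partialSum m k := by
  rw [← hm, partialSum_sum_single]
  constructor
  · intro h
    have : Finset.Iic p ⊆ Finset.univ.filter fun p => j p < k := fun q hq => by
      simpa using (hj (Finset.mem_Iic.1 hq)).trans_lt h
    have := Finset.card_le_card this
    rw [Fin.card_Iic] at this
    omega
  · intro h
    by_contra hk
    have : (Finset.univ.filter fun p => j p < k) ⊆ Finset.Iio p := fun q hq => by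
      rw [Finset.mem_Iio]
      by_contra hqp
      exact hk ((hj (not_lt.1 hqp)).trans_lt (Finset.mem_filter.1 hq).2)
    have := Finset.card_le_card this
    rw [Fin.card_Iio] at this
    omega

lemma exists_monotone_sum_single {d : ℕ} {m : ℕ →₀ ℕ} (hd : m.degree = d) :
    ∃ j : Fin d → ℕ, Monotone j ∧ ∑ p, Finsupp.single (j p) 1 = m := by
  have hex : ∀ p : Fin d, ∃ k, (p : ℕ) < partialSum m (k + 1) := fun p => by
    obtain ⟨k, hk⟩ := exists_partialSum_eq_degree m
    exact ⟨k, by have := partialSum_mono m (Nat.le_succ k); have := p.2; simp at *; omega⟩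
  have key : ∀ (p : Fin d) (k : ℕ), Nat.find (hex p) < k ↔ (p : ℕ) < partialSum m k := by
    intro p k
    constructor
    · exact fun h => (Nat.find_spec (hex p)).trans_le (partialSum_mono m h)
    · intro h
      cases k with
      | zero => simp at h
      | succ k => exact Nat.lt_succ_of_le (Nat.find_min' (hex p) h)
  have hcard : ∀ k, partialSum (∑ p, Finsupp.single (Nat.find (hex p)) 1) k = partialSum m k := by
    intro k
    rw [partialSum_sum_single]
    simp only [key]
    have hk := partialSum_le_degree m k
    rw [hd] at hk
    rw [Fin.card_filter_val_lt, min_eq_right hk]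
  refine ⟨fun p => Nat.find (hex p), fun p q hpq => ?_, ?_⟩
  · by_contra h
    dsimp only at h
    have h1 := (key q _).1 (not_le.1 h)
    have h2 : ¬ (p : ℕ) < partialSum m (Nat.find (hex p)) := fun h' => lt_irrefl _ ((key p _).2 h')
    have : (p : ℕ) ≤ q := hpq
    omega
  · ext i
    have h1 := hcard i
    have h2 := hcard (i + 1)
    rw [partialSum_succ, partialSum_succ, h1] at h2
    exact Nat.add_left_cancel h2

/-- The list that encodes a composition: each part is lowered by one. -/
def Composition.toShifted {d : ℕ} (α : Composition d) : List ℕ := α.blocks.map Nat.pred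

lemma Composition.parts_toShifted {d : ℕ} (α : Composition d) : parts α.toShifted = α.blocks := by
  rw [parts, Composition.toShifted, List.map_map]
  conv_rhs => rw [← List.map_id α.blocks]
  exact List.map_congr_left fun b hb => Nat.succ_pred_eq_of_pos (α.blocks_pos hb)

lemma parts_take (l : List ℕ) (i : ℕ) : parts (l.take i) = (parts l).take i := by
  simp [parts, List.map_take]

lemma Composition.occurs_toShifted {d : ℕ} (α : Composition d) (m : ℕ →₀ ℕ) :
    Occurs α.toShifted m ↔
      m.degree = d ∧ ∀ s ∈ partialSumSet α, s ∈ Set.range (partialSum m) := by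
  rw [Occurs, α.parts_toShifted, α.blocks_sum]
  refine and_congr_right fun hd => ⟨?_, ?_⟩
  · rintro h s ⟨i, -, -, rfl⟩
    have := h _ (List.take_prefix i _)
    rwa [parts_take, α.parts_toShifted] at this
  · intro h p hp
    rw [List.prefix_iff_eq_take.1 hp, parts_take, α.parts_toShifted]
    change α.sizeUpTo p.length ∈ _
    rcases Nat.eq_zero_or_pos p.length with h0 | h0
    · rw [h0, α.sizeUpTo_zero]; exact zero_mem_range_partialSum m
    rcases lt_or_ge p.length α.length with h1 | h1
    · exact h _ ⟨_, h0, h1, rfl⟩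
    · rw [α.sizeUpTo_ofLength_le _ h1, ← hd]
      exact exists_partialSum_eq_degree m

lemma Composition.fundamentalQSym_eq {d : ℕ} (α : Composition d) :
    fundamentalQSym α = listFundamental α.toShifted := by
  classical
  have hstrict : ∀ (m : ℕ →₀ ℕ) (j : Fin d → ℕ), Monotone j → ∑ p, Finsupp.single (j p) 1 = m →
      ∀ p q : Fin d, (p : ℕ) + 1 = q → (j p < j q ↔ (q : ℕ) ∈ Set.range (partialSum m)) := by
    intro m j hj hm p q hpq
    constructor
    · intro h
      have h1 := (lt_iff_of_sum_single hj hm p _).1 h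
      have h2 := (lt_iff_of_sum_single hj hm q (j q)).not.1 (lt_irrefl _)
      exact ⟨j q, by omega⟩
    · rintro ⟨k, hk⟩
      have h1 := (lt_iff_of_sum_single hj hm p k).2 (by omega)
      have h2 := (lt_iff_of_sum_single hj hm q k).not.2 (by omega)
      omega
  have hdeg : ∀ (m : ℕ →₀ ℕ) (j : Fin d → ℕ), ∑ p, Finsupp.single (j p) 1 = m → m.degree = d := by
    rintro m j rfl
    rw [map_sum]
    simp
  have hset : ∀ s ∈ partialSumSet α, 0 < s ∧ s < d := by
    rintro s ⟨i, h0, h1, rfl⟩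
    constructor
    · rw [← α.sizeUpTo_zero]
      exact (α.sizeUpTo_strict_mono (h0.trans h1)).trans_le (α.monotone_sizeUpTo h0)
    · have := α.sizeUpTo_strict_mono h1
      have h2 := α.monotone_sizeUpTo (Nat.succ_le_of_lt h1)
      rw [α.sizeUpTo_length] at h2
      simp at *; omega
  ext m
  rw [coeff_listFundamental, α.occurs_toShifted]
  change ((_ : ℕ) : ℚ) = _
  split_ifs with h
  · obtain ⟨hd, hs⟩ := h
    obtain ⟨j, hj, hjm⟩ := exists_monotone_sum_single hd
    rw [Nat.cast_eq_one, Set.ncard_eq_one]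
    refine ⟨j, ?_⟩
    ext j'
    constructor
    · rintro ⟨⟨hj', -⟩, hjm'⟩
      funext p
      refine eq_of_forall_lt_iff fun k => ?_
      have h1 := lt_iff_of_sum_single hj hjm p (k + 1)
      have h2 := lt_iff_of_sum_single hj' hjm' p (k + 1)
      rw [← not_iff_not, not_lt, not_lt, ← Nat.lt_succ_iff, ← Nat.lt_succ_iff]
      exact h2.trans h1.symm
    · rintro rfl
      exact ⟨⟨hj, fun p q hpq hq => (hstrict m _ hj hjm p q hpq).2 (hs _ hq)⟩, hjm⟩
  · rw [Nat.cast_eq_zero]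
    convert Set.ncard_empty (Fin d → ℕ)
    by_contra hne
    obtain ⟨j, ⟨hj, hjs⟩, hjm⟩ := Set.nonempty_iff_ne_empty.2 hne
    refine h ⟨hdeg m j hjm, fun s hs => ?_⟩
    obtain ⟨h0, h1⟩ := hset s hs
    exact (hstrict m j hj hjm ⟨s - 1, by omega⟩ ⟨s, h1⟩ (by simp; omega)).1
      (hjs _ _ (by simp; omega) hs)

/-! ### The ideals of level `e` -/

lemma sum_parts (l : List ℕ) : (parts l).sum = l.sum + l.length := by
  induction l with
  | nil => rfl
  | cons a l ih => rw [parts_cons, List.sum_cons, ih, List.sum_cons, List.length_cons]; omega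

lemma length_parts (l : List ℕ) : (parts l).length = l.length := List.length_map ..

lemma length_le_sum_of_pos {l : List ℕ} (h : ∀ b ∈ l, 0 < b) : l.length ≤ l.sum := by
  induction l with
  | nil => simp
  | cons b l ih =>
    have h1 := ih fun c hc => h c (List.mem_cons_of_mem _ hc)
    have h2 := h b List.mem_cons_self
    rw [List.length_cons, List.sum_cons]; omega

/-- Since the parts are positive, the difference `d(π) - ℓ(π)` is largest for the whole
composition. -/
lemma Composition.reachesLevel_iff {d : ℕ} (α : Composition d) (e : ℕ) :
    ReachesLevel e α ↔ e ≤ α.toShifted.sum := by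
  have hs := sum_parts α.toShifted
  have hl := length_parts α.toShifted
  rw [α.parts_toShifted] at hs hl
  constructor
  · rintro ⟨π, ρ, hb, he⟩
    have hρ : ρ.length ≤ ρ.sum := length_le_sum_of_pos fun b hbρ =>
      α.blocks_pos (hb ▸ List.mem_append_right _ hbρ)
    rw [hb, List.sum_append] at hs
    rw [hb, List.length_append] at hl
    omega
  · intro he
    exact ⟨α.blocks, [], by simp, by omega⟩

lemma levelIdeal_eq_span (e : ℕ) :
    levelIdeal e = Ideal.span {f | ∃ l : List ℕ, l ≠ [] ∧ e ≤ l.sum ∧ f = listFundamental l} := by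
  rw [levelIdeal]
  congr 1
  ext f
  constructor
  · rintro ⟨d, α, hd, hα, rfl⟩
    refine ⟨α.toShifted, fun h => ?_, (α.reachesLevel_iff e).1 hα, α.fundamentalQSym_eq⟩
    have := α.parts_toShifted
    rw [h] at this
    have hs := α.blocks_sum
    rw [← this] at hs
    simp at hs
    omega
  · rintro ⟨l, hl, he, rfl⟩
    let α : Composition (parts l).sum :=
      ⟨parts l, fun {i} hi => by obtain ⟨a, -, rfl⟩ := List.mem_map.1 hi; omega, rfl⟩
    have hα : α.toShifted = l := by
      simp [α, Composition.toShifted, parts, Function.comp_def]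
    refine ⟨_, α, ?_, (α.reachesLevel_iff e).2 (by rwa [hα]), ?_⟩
    · have := List.length_pos_iff.2 hl
      rw [sum_parts]; omega
    · rw [α.fundamentalQSym_eq, hα]

lemma listFundamental_mem_levelIdeal {e : ℕ} {l : List ℕ} (hl : l ≠ []) (he : e ≤ l.sum) :
    listFundamental l ∈ levelIdeal e := by
  rw [levelIdeal_eq_span]
  exact Ideal.subset_span ⟨l, hl, he, rfl⟩

lemma levelIdeal_zero_eq : levelIdeal 0 = qsymIdeal := by
  rw [levelIdeal, qsymIdeal]
  congr 1
  ext f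
  constructor
  · rintro ⟨d, α, hd, -, rfl⟩
    exact ⟨d, α, hd, rfl⟩
  · rintro ⟨d, α, hd, rfl⟩
    exact ⟨d, α, hd, (α.reachesLevel_iff 0).2 (Nat.zero_le _), rfl⟩

lemma shiftSeries_listFundamental_mem {e : ℕ} (l : List ℕ) (he : e + 1 ≤ l.sum) :
    shiftSeries (listFundamental l) ∈ levelIdeal e := by
  induction l with
  | nil => simp at he
  | cons a l ih =>
    cases a with
    | zero =>
      rw [eq_sub_of_add_eq (listFundamental_zero_cons l).symm]
      have h : e + 1 ≤ l.sum := by simpa using he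
      exact sub_mem (listFundamental_mem_levelIdeal (List.cons_ne_nil _ _) (by simp; omega))
        (Ideal.mul_mem_left _ _ (ih h))
    | succ a =>
      rw [eq_sub_of_add_eq (listFundamental_succ_cons a l).symm]
      rw [List.sum_cons] at he
      exact sub_mem (listFundamental_mem_levelIdeal (List.cons_ne_nil _ _) (by simp; omega))
        (Ideal.mul_mem_left _ _
          (listFundamental_mem_levelIdeal (List.cons_ne_nil _ _) (by simp; omega)))

/-- Shifting the variables lowers the level by one. -/
lemma shiftSeries_mem_levelIdeal {e : ℕ} {f : QSeries} (hf : f ∈ levelIdeal (e + 1)) :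
    shiftSeries f ∈ levelIdeal e := by
  rw [levelIdeal_eq_span] at hf
  induction hf using Submodule.span_induction with
  | mem f hf =>
    obtain ⟨l, -, hl, rfl⟩ := hf
    exact shiftSeries_listFundamental_mem l hl
  | zero => rw [map_zero]; exact zero_mem _
  | add f g _ _ hf hg => rw [map_add]; exact add_mem hf hg
  | smul c f _ hf => rw [smul_eq_mul, map_mul]; exact Ideal.mul_mem_left _ _ hf

/-! ### Leading monomials -/

/-- The space of series all of whose monomials have degree less than `a` in the first variable. -/
def firstDegreeLT (a : ℕ) : Submodule ℚ QSeries where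
  carrier := {f | ∀ m : ℕ →₀ ℕ, a ≤ m 0 → MvPowerSeries.coeff m f = 0}
  add_mem' hf hg m hm := by rw [map_add, hf m hm, hg m hm, add_zero]
  zero_mem' m _ := by rw [map_zero]
  smul_mem' c f hf m hm := by rw [map_smul, hf m hm, smul_zero]

lemma firstDegreeLT_mono {a b : ℕ} (h : a ≤ b) : firstDegreeLT a ≤ firstDegreeLT b :=
  fun _ hf m hm => hf m (h.trans hm)

lemma shiftSeries_mul_mem_firstDegreeLT {a : ℕ} (g : QSeries) {f : QSeries}
    (hf : f ∈ firstDegreeLT a) : shiftSeries g * f ∈ firstDegreeLT a := by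
  classical
  intro m hm
  rw [MvPowerSeries.coeff_mul]
  refine Finset.sum_eq_zero fun p hp => ?_
  rw [coeff_shiftSeries]
  split_ifs with h
  · have : p.1 0 + p.2 0 = m 0 := by rw [← Finset.HasAntidiagonal.mem_antidiagonal.1 hp]; rfl
    rw [hf p.2 (by omega), mul_zero]
  · rw [zero_mul]

lemma X_zero_mul_mem_firstDegreeLT {a : ℕ} {f : QSeries} (hf : f ∈ firstDegreeLT a) :
    MvPowerSeries.X 0 * f ∈ firstDegreeLT (a + 1) := by
  intro m hm
  rw [coeff_X_zero_mul]
  split_ifs with h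
  · exact hf _ (by simp; omega)
  · rfl

lemma shiftSeries_mem_firstDegreeLT (f : QSeries) : shiftSeries f ∈ firstDegreeLT 1 := by
  intro m hm
  rw [coeff_shiftSeries, if_neg (by omega)]

lemma coeff_X_zero_pow_mul_shiftSeries (a : ℕ) (f : QSeries) (m : ℕ →₀ ℕ) :
    MvPowerSeries.coeff m (MvPowerSeries.X 0 ^ a * shiftSeries f) =
      if m 0 = a then MvPowerSeries.coeff (tailExp m) f else 0 := by
  induction a generalizing m with
  | zero => rw [pow_zero, one_mul, coeff_shiftSeries]
  | succ a ih =>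
    rw [pow_succ', mul_assoc, coeff_X_zero_mul]
    have ht : tailExp (m - Finsupp.single 0 1) = tailExp m := by ext i; simp
    split_ifs with h1 h2 h2
    · rw [ih, ht, if_pos (by simp; omega)]
    · rw [ih, if_neg (by simp; omega)]
    · omega
    · rfl

/-- In terms of the first variable, the leading term of `F_α` for `α = [a + 1] ⬝ β` is `x₁^{a+1}`
times the shift of `F_β`. -/
lemma listFundamental_cons_sub_mem (a : ℕ) (l : List ℕ) :
    listFundamental (a :: l) - MvPowerSeries.X 0 ^ (a + 1) * shiftSeries (listFundamental l) ∈
      firstDegreeLT (a + 1) := by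
  induction a with
  | zero =>
    rw [zero_add, pow_one, sub_eq_of_eq_add (listFundamental_zero_cons l)]
    exact shiftSeries_mem_firstDegreeLT _
  | succ a ih =>
    have h : listFundamental ((a + 1) :: l) -
          MvPowerSeries.X 0 ^ (a + 1 + 1) * shiftSeries (listFundamental l) =
        shiftSeries (listFundamental ((a + 1) :: l)) + MvPowerSeries.X 0 *
          (listFundamental (a :: l) -
            MvPowerSeries.X 0 ^ (a + 1) * shiftSeries (listFundamental l)) := by
      linear_combination listFundamental_succ_cons a l
    rw [h]
    exact add_mem (firstDegreeLT_mono (by omega) (shiftSeries_mem_firstDegreeLT _))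
      (X_zero_mul_mem_firstDegreeLT ih)

/-- Every element of the ideal of level `e - a` is, up to a shift, the leading coefficient with
respect to `x₁` of an element of the ideal of level `e` in which `x₁` has degree `a + 1`. -/
lemma exists_lift_mem_levelIdeal {e a : ℕ} {f : QSeries} (hf : f ∈ levelIdeal (e - a)) :
    ∃ g ∈ levelIdeal e,
      g - MvPowerSeries.X 0 ^ (a + 1) * shiftSeries f ∈ firstDegreeLT (a + 1) := by
  rw [levelIdeal_eq_span] at hf
  induction hf using Submodule.span_induction with
  | mem f hf =>
    obtain ⟨l, -, hl, rfl⟩ := hf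
    exact ⟨_, listFundamental_mem_levelIdeal (List.cons_ne_nil a l) (by simp; omega),
      listFundamental_cons_sub_mem a l⟩
  | zero => exact ⟨0, zero_mem _, by simp⟩
  | add f₁ f₂ _ _ h₁ h₂ =>
    obtain ⟨g₁, hg₁, h₁⟩ := h₁
    obtain ⟨g₂, hg₂, h₂⟩ := h₂
    refine ⟨g₁ + g₂, add_mem hg₁ hg₂, ?_⟩
    rw [map_add, mul_add, add_sub_add_comm]
    exact add_mem h₁ h₂
  | smul c f _ h =>
    obtain ⟨g, hg, h⟩ := h
    refine ⟨shiftSeries c * g, Ideal.mul_mem_left _ _ hg, ?_⟩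
    have := shiftSeries_mul_mem_firstDegreeLT c h
    rwa [mul_sub, mul_left_comm, ← map_mul] at this

lemma isECatalan_iff (e : ℕ) (a : ℕ →₀ ℕ) :
    IsECatalan e a ↔ ∀ k, partialSum a (k + 1) ≤ k + e := by
  constructor
  · intro h k
    have := h (partialSum a (k + 1), k) ⟨partialSum_mono a (Nat.le_succ k), le_rfl⟩
    simp at this
    omega
  · rintro h ⟨x, y⟩ ⟨-, hP⟩
    have h1 := h y
    change x ≤ partialSum a (y + 1) at hP
    change (x : ℤ) - (y : ℤ) ≤ e
    omega

/-- The lexicographic order on exponent sequences, with `x₁ > x₂ > ⋯`. -/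
def LexLT (m m' : ℕ →₀ ℕ) : Prop := toLex m < toLex m'

lemma lexLT_of_zero_lt {m m' : ℕ →₀ ℕ} (h : m 0 < m' 0) : LexLT m m' :=
  Finsupp.Lex.lt_iff.2 ⟨0, fun j hj => absurd hj (Nat.not_lt_zero j), h⟩

lemma lexLT_of_tailExp {m m' : ℕ →₀ ℕ} (h0 : m 0 = m' 0) (h : LexLT (tailExp m) (tailExp m')) :
    LexLT m m' := by
  obtain ⟨i, hi, hlt⟩ := Finsupp.Lex.lt_iff.1 h
  refine Finsupp.Lex.lt_iff.2 ⟨i + 1, fun j hj => ?_, hlt⟩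
  cases j with
  | zero => exact h0
  | succ j => exact hi j (by omega)

/-- The monomial `ε` occurs in `f` with coefficient `1`, and is the largest monomial of `f`. -/
def HasLeading (f : QSeries) (ε : ℕ →₀ ℕ) : Prop :=
  MvPowerSeries.coeff ε f = 1 ∧ ∀ m, m ≠ ε → MvPowerSeries.coeff m f ≠ 0 → LexLT m ε

lemma hasLeading_monomial (ε : ℕ →₀ ℕ) : HasLeading (MvPowerSeries.monomial ε 1) ε := by
  classical
  refine ⟨MvPowerSeries.coeff_monomial_same _ _, fun m hm h => absurd ?_ h⟩
  rw [MvPowerSeries.coeff_monomial, if_neg hm]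

lemma HasLeading.of_tailExp {f g : QSeries} {ε : ℕ →₀ ℕ} (hf : HasLeading f (tailExp ε))
    (hg : g - MvPowerSeries.X 0 ^ (ε 0) * shiftSeries f ∈ firstDegreeLT (ε 0)) :
    HasLeading g ε := by
  have key : ∀ m : ℕ →₀ ℕ, ε 0 ≤ m 0 → MvPowerSeries.coeff m g =
      if m 0 = ε 0 then MvPowerSeries.coeff (tailExp m) f else 0 := by
    intro m hm
    have := hg m hm
    rw [map_sub, coeff_X_zero_pow_mul_shiftSeries] at this
    exact sub_eq_zero.1 this
  refine ⟨by rw [key ε le_rfl, if_pos rfl, hf.1], fun m hm h => ?_⟩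
  rcases lt_or_ge (m 0) (ε 0) with h1 | h1
  · exact lexLT_of_zero_lt h1
  · rw [key m h1] at h
    split_ifs at h with h2
    · refine lexLT_of_tailExp h2 (hf.2 _ (fun h3 => hm ?_) h)
      rw [← single_add_embDomain_tailExp m, ← single_add_embDomain_tailExp ε, h2, h3]
    · exact absurd rfl h

lemma exists_hasLeading_mem_levelIdeal_of_lt {e : ℕ} {ε : ℕ →₀ ℕ} (h : e < ε 0) :
    ∃ g ∈ levelIdeal e, HasLeading g ε := by
  obtain ⟨a, ha⟩ : ∃ a, ε 0 = a + 1 := ⟨ε 0 - 1, by omega⟩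
  refine ⟨shiftSeries (MvPowerSeries.monomial (tailExp ε) 1) * listFundamental [a],
    Ideal.mul_mem_left _ _ (listFundamental_mem_levelIdeal (List.cons_ne_nil _ _)
      (by simp; omega)), (hasLeading_monomial _).of_tailExp ?_⟩
  have := shiftSeries_mul_mem_firstDegreeLT (MvPowerSeries.monomial (tailExp ε) 1)
    (listFundamental_cons_sub_mem a [])
  rwa [listFundamental_nil, map_one shiftSeries, mul_one, mul_sub,
    mul_comm _ (MvPowerSeries.X 0 ^ _), ← ha] at this

/-- If the path of `ε` crosses the line `y = x - e`, then `ε` is the leading monomial of an element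
of the ideal of level `e`. -/
lemma exists_hasLeading_mem_levelIdeal {e : ℕ} {ε : ℕ →₀ ℕ} (hε : ¬ IsECatalan e ε) :
    ∃ g ∈ levelIdeal e, HasLeading g ε := by
  rw [isECatalan_iff] at hε
  push Not at hε
  obtain ⟨k, hk⟩ := hε
  induction k generalizing e ε with
  | zero =>
    rw [partialSum_succ', partialSum_zero] at hk
    exact exists_hasLeading_mem_levelIdeal_of_lt (by omega)
  | succ k ih =>
    rw [partialSum_succ'] at hk
    rcases lt_or_ge e (ε 0) with h1 | h1
    · exact exists_hasLeading_mem_levelIdeal_of_lt h1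
    rcases Nat.eq_zero_or_pos (ε 0) with h0 | h0
    · obtain ⟨g, hg, hl⟩ := ih (e := e + 1) (ε := tailExp ε) (by omega)
      refine ⟨shiftSeries g, shiftSeries_mem_levelIdeal hg, hl.of_tailExp ?_⟩
      rw [h0, pow_zero, one_mul, sub_self]
      exact zero_mem _
    · obtain ⟨a, ha⟩ : ∃ a, ε 0 = a + 1 := ⟨ε 0 - 1, by omega⟩
      obtain ⟨f, hf, hl⟩ := ih (e := e - a) (ε := tailExp ε) (by omega)
      obtain ⟨g, hg, h⟩ := exists_lift_mem_levelIdeal hf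
      exact ⟨g, hg, hl.of_tailExp (by rwa [ha])⟩

/-! ### Closure and duality -/

lemma mem_closure_iff_forall_finset {I : Ideal QSeries} {f : QSeries} :
    f ∈ I.closure ↔ ∀ T : Finset (ℕ →₀ ℕ), ∃ g ∈ I,
      ∀ m ∈ T, MvPowerSeries.coeff m g = MvPowerSeries.coeff m f := by
  let _ : TopologicalSpace ℚ := ⊥
  have : DiscreteTopology ℚ := ⟨rfl⟩
  rw [← SetLike.mem_coe, Ideal.coe_closure, mem_closure_iff]
  constructor
  · intro h T
    obtain ⟨g, hgT, hg⟩ := h ((T : Set (ℕ →₀ ℕ)).pi fun m => {MvPowerSeries.coeff m f})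
      (isOpen_set_pi T.finite_toSet fun m _ => isOpen_discrete _) fun m _ => rfl
    exact ⟨g, hg, fun m hm => hgT m hm⟩
  · intro h o ho hfo
    obtain ⟨T, u, hu, hT⟩ := isOpen_pi_iff.1 ho f hfo
    obtain ⟨g, hg, hgf⟩ := h T
    refine ⟨g, hT fun m hm => ?_, hg⟩
    have : g m = f m := hgf m hm
    rw [this]
    exact (hu m hm).2

/-- The pairing of a series with a finitely supported family of coefficients. -/
noncomputable def pairing (f : QSeries) : ((ℕ →₀ ℕ) →₀ ℚ) →ₗ[ℚ] ℚ :=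
  Finsupp.linearCombination ℚ fun m => MvPowerSeries.coeff m f

lemma pairing_single (f : QSeries) (m : ℕ →₀ ℕ) (c : ℚ) :
    pairing f (Finsupp.single m c) = c * MvPowerSeries.coeff m f := by
  rw [pairing, Finsupp.linearCombination_single, smul_eq_mul]

lemma pairing_sub (f g : QSeries) (p : (ℕ →₀ ℕ) →₀ ℚ) :
    pairing (f - g) p = pairing f p - pairing g p := by
  simp [pairing, Finsupp.linearCombination_apply, Finsupp.sum, mul_sub, Finset.sum_sub_distrib]

/-- The finitely supported functionals that vanish on `I`. -/
noncomputable def annihilator (I : Ideal QSeries) : Submodule ℚ ((ℕ →₀ ℕ) →₀ ℚ) where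
  carrier := {p | ∀ g ∈ I, pairing g p = 0}
  add_mem' hp hq g hg := by rw [map_add, hp g hg, hq g hg, add_zero]
  zero_mem' g _ := map_zero _
  smul_mem' c p hp g hg := by rw [map_smul, hp g hg, smul_zero]

/-- Bipolar theorem: a series killed by the annihilator of `I` lies in the closure of `I`. -/
lemma mem_closure_of_forall_annihilator {I : Ideal QSeries} {f : QSeries}
    (h : ∀ p ∈ annihilator I, pairing f p = 0) : f ∈ I.closure := by
  classical
  rw [mem_closure_iff_forall_finset]
  intro T
  let res : QSeries →ₗ[ℚ] (T → ℚ) := LinearMap.pi fun m => MvPowerSeries.coeff (m : ℕ →₀ ℕ)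
  by_contra hne
  have hres : res f ∉ (I.restrictScalars ℚ).map res := by
    rintro ⟨g, hg, hgf⟩
    exact hne ⟨g, hg, fun m hm => congrFun hgf ⟨m, hm⟩⟩
  obtain ⟨φ, hφ, hφI⟩ := Submodule.exists_dual_map_eq_bot_of_notMem hres inferInstance
  let p : (ℕ →₀ ℕ) →₀ ℚ := ∑ m : T, Finsupp.single (m : ℕ →₀ ℕ) (φ (Pi.single m 1))
  have key : ∀ g : QSeries, pairing g p = φ (res g) := by
    intro g
    rw [← LinearMap.sum_single_apply _ (res g), map_sum, map_sum]
    refine Finset.sum_congr rfl fun m _ => ?_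
    have : (Pi.single m (res g m) : T → ℚ) = res g m • Pi.single m 1 := by
      rw [← Pi.single_smul, smul_eq_mul, mul_one]
    rw [pairing_single, this, map_smul, smul_eq_mul, mul_comm]
    rfl
  refine hφ ?_
  rw [← key]
  refine h p fun g hg => ?_
  rw [key]
  have : φ (res g) ∈ ((I.restrictScalars ℚ).map res).map φ := ⟨_, ⟨g, hg, rfl⟩, rfl⟩
  rwa [hφI] at this

lemma eq_zero_of_mem_annihilator {I : Ideal QSeries} {S : Set (ℕ →₀ ℕ)}
    (hS : ∀ ε, ε ∉ S → ∃ g ∈ I, HasLeading g ε) {p : (ℕ →₀ ℕ) →₀ ℚ} (hp : p ∈ annihilator I)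
    (hpS : ∀ m ∈ S, p m = 0) : p = 0 := by
  by_contra hne
  -- At the smallest monomial `ε` of `p`, the functional `p` sees only the leading term of `g`.
  obtain ⟨ε, hε, hmin⟩ :=
    Finset.exists_min_image p.support toLex (Finsupp.support_nonempty_iff.2 hne)
  have hpε := Finsupp.mem_support_iff.1 hε
  obtain ⟨g, hg, h1, hlt⟩ := hS ε fun h => hpε (hpS ε h)
  have := hp g hg
  rw [pairing, Finsupp.linearCombination_apply, Finsupp.sum, Finset.sum_eq_single ε, h1] at this
  · exact hpε (by simpa using this)
  · intro m hm hmε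
    by_contra h
    have h2 : MvPowerSeries.coeff m g ≠ 0 := fun h3 => h (by rw [h3, smul_zero])
    exact absurd (hmin m hm) (not_le.2 (hlt m hmε h2))
  · exact fun h => absurd hε h

/-- If every monomial outside `S` is a leading monomial of the ideal `I`, then every series is
congruent, modulo the closure of `I`, to a series supported on `S`. -/
lemma exists_sub_mem_closure {I : Ideal QSeries} {S : Set (ℕ →₀ ℕ)}
    (hS : ∀ ε, ε ∉ S → ∃ g ∈ I, HasLeading g ε) (f : QSeries) :
    ∃ g : QSeries, (∀ m, m ∉ S → MvPowerSeries.coeff m g = 0) ∧ f - g ∈ I.closure := by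
  classical
  -- The restriction to `S` is injective on the annihilator of `I`; hence the functional given by
  -- `f` on the annihilator depends only on the coordinates in `S`.
  let r : annihilator I →ₗ[ℚ] (S →₀ ℚ) :=
    (Finsupp.lsubtypeDomain S).comp (annihilator I).subtype
  have hr : LinearMap.ker r = ⊥ := by
    rw [LinearMap.ker_eq_bot']
    rintro ⟨p, hp⟩ hrp
    refine Subtype.ext (eq_zero_of_mem_annihilator hS hp fun m hm => ?_)
    exact DFunLike.congr_fun hrp (⟨m, hm⟩ : S)
  obtain ⟨s, hs⟩ := r.exists_leftInverse_of_injective hr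
  let φ : (S →₀ ℚ) →ₗ[ℚ] ℚ := (pairing f).comp ((annihilator I).subtype.comp s)
  let g : QSeries := fun m => if h : m ∈ S then φ (Finsupp.single ⟨m, h⟩ 1) else 0
  have hg : ∀ m, MvPowerSeries.coeff m g =
      if h : m ∈ S then φ (Finsupp.single ⟨m, h⟩ 1) else 0 := fun m => rfl
  have hgφ : pairing g = φ.comp (Finsupp.lsubtypeDomain S) := by
    refine Finsupp.lhom_ext fun m c => ?_
    rw [pairing_single, hg, LinearMap.comp_apply, Finsupp.lsubtypeDomain_apply]
    split_ifs with h
    · have : Finsupp.subtypeDomain (· ∈ S) (Finsupp.single m c) =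
          c • Finsupp.single (⟨m, h⟩ : S) (1 : ℚ) := by
        ext x
        simp [Finsupp.single_apply, Subtype.ext_iff]
      rw [this, map_smul, smul_eq_mul]
    · have : Finsupp.subtypeDomain (· ∈ S) (Finsupp.single m c) = 0 := by
        ext x
        have : m ≠ x := fun hx => h (hx ▸ x.2)
        simp [this]
      rw [this, map_zero, mul_zero]
  refine ⟨g, fun m hm => by rw [hg, dif_neg hm], mem_closure_of_forall_annihilator fun p hp => ?_⟩
  have h1 : s (r ⟨p, hp⟩) = ⟨p, hp⟩ := LinearMap.congr_fun hs ⟨p, hp⟩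
  have h2 : pairing g p = pairing f (s (r ⟨p, hp⟩)) := by rw [hgφ]; rfl
  rw [pairing_sub, h2, h1, sub_self]

/-! ### Evaluation of quasi-symmetric functions, one variable at a time -/

section Letters

variable {A : Type*} [CommRing A]

/-- Adding a variable: if `φ l` is the value of the fundamental function of `parts l` at
`(x₁, x₂, …)`, then `addLetter x φ l` is its value at `(x, x₁, x₂, …)`. -/
def addLetter (x : A) (φ : List ℕ → A) : List ℕ → A
  | [] => φ []
  | 0 :: l => φ (0 :: l) + x * φ l
  | (a + 1) :: l => φ ((a + 1) :: l) + x * addLetter x φ (a :: l)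

/-- Removing a variable; the inverse of `addLetter`. -/
def removeLetter (x : A) (φ : List ℕ → A) : List ℕ → A
  | [] => φ []
  | 0 :: l => φ (0 :: l) - x * removeLetter x φ l
  | (a + 1) :: l => φ ((a + 1) :: l) - x * φ (a :: l)

/-- The values of the fundamental functions in no variables. -/
def noLetter : List ℕ → A
  | [] => 1
  | _ :: _ => 0

lemma addLetter_removeLetter (x : A) (φ : List ℕ → A) :
    addLetter x (removeLetter x φ) = φ := by
  funext l
  cases l with
  | nil => rw [addLetter, removeLetter]
  | cons a l =>
    induction a with
    | zero => rw [addLetter, removeLetter]; ring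
    | succ a ih => rw [addLetter, ih, removeLetter]; ring

lemma removeLetter_addLetter (x : A) (φ : List ℕ → A) :
    removeLetter x (addLetter x φ) = φ := by
  funext l
  induction l with
  | nil => rw [removeLetter, addLetter]
  | cons a l ih =>
    cases a with
    | zero => rw [removeLetter, ih, addLetter]; ring
    | succ a => rw [removeLetter, addLetter]; ring

/-- Adding a variable, as a permutation of the set of value functions. -/
def letterPerm (x : A) : Equiv.Perm (List ℕ → A) where
  toFun := addLetter x
  invFun := removeLetter x
  left_inv := removeLetter_addLetter x
  right_inv := addLetter_removeLetter x

lemma addLetter_sub (x : A) (φ ψ : List ℕ → A) (l : List ℕ) :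
    addLetter x (φ - ψ) l = addLetter x φ l - addLetter x ψ l := by
  cases l with
  | nil => simp only [addLetter, Pi.sub_apply]
  | cons a l =>
    induction a with
    | zero => simp only [addLetter, Pi.sub_apply]; ring
    | succ a ih => rw [addLetter, ih, addLetter, addLetter, Pi.sub_apply]; ring

lemma map_addLetter {B : Type*} [CommRing B] (f : A →+* B) (x : A) (φ : List ℕ → A) (l : List ℕ) :
    f (addLetter x φ l) = addLetter (f x) (fun l => f (φ l)) l := by
  cases l with
  | nil => simp only [addLetter]
  | cons a l =>
    induction a with
    | zero => simp only [addLetter, map_add, map_mul]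
    | succ a ih => rw [addLetter, map_add, map_mul, ih, addLetter]

lemma map_removeLetter {B : Type*} [CommRing B] (f : A →+* B) (x : A) (φ : List ℕ → A)
    (l : List ℕ) : f (removeLetter x φ l) = removeLetter (f x) (fun l => f (φ l)) l := by
  induction l with
  | nil => simp only [removeLetter]
  | cons a l ih =>
    cases a with
    | zero => rw [removeLetter, map_sub, map_mul, ih, removeLetter]
    | succ a => simp only [removeLetter, map_sub, map_mul]

lemma map_noLetter {B : Type*} [CommRing B] (f : A →+* B) (l : List ℕ) :
    f (noLetter l) = noLetter l := by
  cases l <;> simp [noLetter]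

end Letters

/-! ### Homogeneous components of the restriction to finitely many variables -/

section Evaluation

variable {A : Type*} [CommRing A]

/-- The exponent sequences of degree `d` that involve the first `n` variables only. -/
def exponents (n d : ℕ) : Finset (ℕ →₀ ℕ) := Finset.finsuppAntidiag (Finset.range n) d

lemma mem_exponents {n d : ℕ} {m : ℕ →₀ ℕ} :
    m ∈ exponents n d ↔ m.degree = d ∧ ∀ i, n ≤ i → m i = 0 := by
  rw [exponents, Finset.mem_finsuppAntidiag']
  refine and_congr Iff.rfl ?_
  simp only [Finset.subset_iff, Finsupp.mem_support_iff, Finset.mem_range]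
  exact forall_congr' fun i => by rw [← not_lt]; tauto

/-- The value of the monomial `m` at `(X₀, …, X_{n-1})`. -/
def monomialValue (n : ℕ) (X : ℕ → A) (m : ℕ →₀ ℕ) : A := ∏ i ∈ Finset.range n, X i ^ m i

lemma monomialValue_add (n : ℕ) (X : ℕ → A) (m m' : ℕ →₀ ℕ) :
    monomialValue n X (m + m') = monomialValue n X m * monomialValue n X m' := by
  simp [monomialValue, pow_add, Finset.prod_mul_distrib]

lemma monomialValue_zero (n : ℕ) (X : ℕ → A) : monomialValue n X 0 = 1 := by
  simp [monomialValue]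

lemma monomialValue_single {n : ℕ} (X : ℕ → A) {i : ℕ} (hi : i < n) :
    monomialValue n X (Finsupp.single i 1) = X i := by
  rw [monomialValue, Finset.prod_eq_single i]
  · simp
  · intro j _ hj; simp [hj.symm]
  · intro h; exact absurd (Finset.mem_range.2 hi) h

lemma monomialValue_succ (n : ℕ) (X : ℕ → A) (m : ℕ →₀ ℕ) :
    monomialValue (n + 1) X m = X 0 ^ m 0 * monomialValue n (fun i => X (i + 1)) (tailExp m) := by
  rw [monomialValue, Finset.prod_range_succ', mul_comm]; rfl

variable [Algebra ℚ A]

/-- The value at `(X₀, …, X_{n-1})` of the homogeneous component of degree `d` of the series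
obtained from `f` by putting the variables other than the first `n` equal to `0`. -/
noncomputable def componentValue (n d : ℕ) (X : ℕ → A) : QSeries →ₗ[ℚ] A where
  toFun f := ∑ m ∈ exponents n d, MvPowerSeries.coeff m f • monomialValue n X m
  map_add' f g := by simp [add_smul, Finset.sum_add_distrib]
  map_smul' c f := by simp [Finset.smul_sum, mul_smul]

lemma componentValue_apply (n d : ℕ) (X : ℕ → A) (f : QSeries) : componentValue n d X f =
    ∑ m ∈ exponents n d, MvPowerSeries.coeff m f • monomialValue n X m := rfl

lemma componentValue_mul (n d : ℕ) (X : ℕ → A) (f g : QSeries) :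
    componentValue n d X (f * g) = ∑ p ∈ Finset.HasAntidiagonal.antidiagonal d,
      componentValue n p.1 X f * componentValue n p.2 X g := by
  classical
  simp only [componentValue_apply, MvPowerSeries.coeff_mul, Finset.sum_smul,
    Finset.sum_mul_sum, ← Finset.sum_product', Finset.sum_sigma']
  refine Finset.sum_bij' (fun x _ => ⟨(x.2.1.degree, x.2.2.degree), x.2⟩)
    (fun x _ => ⟨x.2.1 + x.2.2, x.2⟩) ?_ ?_ ?_ ?_ ?_
  · rintro ⟨m, a, b⟩ h
    simp only [Finset.mem_sigma, mem_exponents, Finset.HasAntidiagonal.mem_antidiagonal, Finset.mem_product] at h ⊢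
    obtain ⟨⟨hd, hm⟩, hab⟩ := h
    subst hab
    refine ⟨by rw [← hd, map_add], ⟨trivial, fun i hi => ?_⟩, trivial, fun i hi => ?_⟩ <;>
    · have := hm i hi
      simp at this
      tauto
  · rintro ⟨⟨i, j⟩, a, b⟩ h
    simp only [Finset.mem_sigma, mem_exponents, Finset.HasAntidiagonal.mem_antidiagonal, Finset.mem_product] at h ⊢
    obtain ⟨hij, ⟨ha, ha'⟩, hb, hb'⟩ := h
    refine ⟨⟨by rw [map_add, ha, hb, hij], fun k hk => ?_⟩, trivial⟩
    simp [ha' k hk, hb' k hk]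
  · rintro ⟨m, a, b⟩ h
    simp only [Finset.mem_sigma, Finset.HasAntidiagonal.mem_antidiagonal] at h
    obtain ⟨-, rfl⟩ := h
    rfl
  · rintro ⟨⟨i, j⟩, a, b⟩ h
    simp only [Finset.mem_sigma, mem_exponents, Finset.mem_product] at h
    obtain ⟨-, ⟨rfl, -⟩, rfl, -⟩ := h
    rfl
  · rintro ⟨m, a, b⟩ h
    simp only [Finset.mem_sigma, Finset.HasAntidiagonal.mem_antidiagonal] at h
    obtain ⟨-, rfl⟩ := h
    simp only [monomialValue_add, smul_mul_smul_comm]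

lemma componentValue_shiftSeries (n d : ℕ) (X : ℕ → A) (f : QSeries) :
    componentValue (n + 1) d X (shiftSeries f) = componentValue n d (fun i => X (i + 1)) f := by
  classical
  simp only [componentValue_apply, coeff_shiftSeries, ite_smul, zero_smul]
  rw [← Finset.sum_filter]
  refine Finset.sum_bij' (fun m _ => tailExp m) (fun m _ => m.embDomain succEmb) ?_ ?_ ?_ ?_ ?_
  · intro m hm
    rw [Finset.mem_filter, mem_exponents] at hm
    obtain ⟨⟨hd, hs⟩, h0⟩ := hm
    rw [degree_eq_add_tailExp, h0, zero_add] at hd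
    exact mem_exponents.2 ⟨hd, fun i hi => hs _ (by omega)⟩
  · intro m hm
    obtain ⟨hd, hs⟩ := mem_exponents.1 hm
    rw [Finset.mem_filter, mem_exponents]
    refine ⟨⟨?_, fun i hi => ?_⟩, embDomain_succ_zero m⟩
    · rw [degree_eq_add_tailExp, embDomain_succ_zero, tailExp_embDomain, hd, zero_add]
    · obtain ⟨j, rfl⟩ : ∃ j, i = j + 1 := ⟨i - 1, by omega⟩
      rw [embDomain_succ_succ]
      exact hs j (by omega)
  · intro m hm
    exact embDomain_tailExp (Finset.mem_filter.1 hm).2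
  · intro m _
    exact tailExp_embDomain m
  · intro m hm
    rw [monomialValue_succ, (Finset.mem_filter.1 hm).2, pow_zero, one_mul]

lemma componentValue_X_zero_mul (n d : ℕ) (X : ℕ → A) (f : QSeries) :
    componentValue (n + 1) (d + 1) X (MvPowerSeries.X 0 * f) =
      X 0 * componentValue (n + 1) d X f := by
  classical
  simp only [componentValue_apply, coeff_X_zero_mul, ite_smul, zero_smul]
  rw [← Finset.sum_filter, Finset.mul_sum]
  have hle : ∀ {m : ℕ →₀ ℕ}, 1 ≤ m 0 → m - Finsupp.single 0 1 + Finsupp.single 0 1 = m :=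
    fun h => tsub_add_cancel_of_le (Finsupp.single_le_iff.2 h)
  refine Finset.sum_bij' (fun m _ => m - Finsupp.single 0 1) (fun m _ => m + Finsupp.single 0 1)
    ?_ ?_ ?_ ?_ ?_
  · intro m hm
    rw [Finset.mem_filter, mem_exponents] at hm
    obtain ⟨⟨hd, hs⟩, h0⟩ := hm
    rw [degree_sub_single h0] at hd
    exact mem_exponents.2 ⟨by omega, fun i hi => by simp [hs i hi]⟩
  · intro m hm
    obtain ⟨hd, hs⟩ := mem_exponents.1 hm
    rw [Finset.mem_filter, mem_exponents]
    refine ⟨⟨by rw [map_add, hd, Finsupp.degree_single], fun i hi => ?_⟩, by simp⟩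
    have : (0 : ℕ) ≠ i := by omega
    simp [hs i hi, this]
  · intro m hm
    exact hle (Finset.mem_filter.1 hm).2
  · intro m _
    simp
  · intro m hm
    conv_lhs => rw [← hle (Finset.mem_filter.1 hm).2, monomialValue_add,
      monomialValue_single X (Nat.succ_pos n)]
    rw [add_tsub_cancel_right, mul_comm, mul_smul_comm]

lemma componentValue_of_not_mem {n d : ℕ} {X : ℕ → A} {f : QSeries}
    (h : ∀ m ∈ exponents n d, MvPowerSeries.coeff m f = 0) : componentValue n d X f = 0 := by
  rw [componentValue_apply]
  exact Finset.sum_eq_zero fun m hm => by rw [h m hm, zero_smul]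

/-- The fundamental function of `parts l` is homogeneous. -/
lemma componentValue_listFundamental_of_ne {n d : ℕ} (X : ℕ → A) {l : List ℕ}
    (h : d ≠ (parts l).sum) : componentValue n d X (listFundamental l) = 0 := by
  classical
  refine componentValue_of_not_mem fun m hm => ?_
  rw [coeff_listFundamental, if_neg]
  exact fun ho => h ((mem_exponents.1 hm).1.symm.trans ho.1)

/-- The values of the fundamental functions at `(X₀, …, X_{n-1})` arise by adding one variable at a
time. -/
lemma componentValue_listFundamental (n : ℕ) (X : ℕ → A) (l : List ℕ) :
    componentValue n (parts l).sum X (listFundamental l) =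
      (List.range n).foldr (fun i φ => addLetter (X i) φ) noLetter l := by
  induction n generalizing X l with
  | zero =>
    rw [List.range_zero, List.foldr_nil]
    cases l with
    | nil =>
      rw [listFundamental_nil, componentValue_apply]
      simp [exponents, noLetter, monomialValue_zero]
    | cons a l =>
      refine componentValue_of_not_mem fun m hm => ?_
      exfalso
      obtain ⟨hd, hs⟩ := mem_exponents.1 hm
      have : m = 0 := by ext i; exact hs i (Nat.zero_le i)
      rw [this] at hd
      simp at hd
      omega
  | succ n ih =>
    rw [List.range_succ_eq_map, List.foldr_cons, List.foldr_map]
    have ih' : ∀ l, componentValue (n + 1) (parts l).sum X (shiftSeries (listFundamental l)) =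
        (List.range n).foldr (fun i φ => addLetter (X (i + 1)) φ) noLetter l := fun l => by
      rw [componentValue_shiftSeries, ih]
    cases l with
    | nil =>
      rw [addLetter, ← ih', listFundamental_nil, map_one shiftSeries]
    | cons a l =>
      induction a with
      | zero =>
        have hs : (parts (0 :: l)).sum = (parts l).sum + 1 := by simp [add_comm]
        rw [addLetter, ← ih', ← ih']
        conv_lhs => rw [listFundamental_zero_cons, map_add]
        congr 1
        rw [hs, componentValue_X_zero_mul]
      | succ a iha =>
        have hs : (parts ((a + 1) :: l)).sum = (parts (a :: l)).sum + 1 := by simp; omega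
        rw [addLetter, ← iha, ← ih']
        conv_lhs => rw [listFundamental_succ_cons, map_add]
        congr 1
        rw [hs, componentValue_X_zero_mul]

end Evaluation

/-! ### Points from noncrossing partitions -/

/-- The product of `u z * (u i)⁻¹` over the pairs `(z, i)` of a list. -/
def pairWord {G : Type*} [Group G] (u : ℕ → G) (L : List (ℕ × ℕ)) : G :=
  (L.map fun p => u p.1 * (u p.2)⁻¹).prod

/-- The concatenation of a stack of lists, starting from the bottom of the stack. -/
def unstack (s : List (List (ℕ × ℕ))) : List (ℕ × ℕ) := s.reverse.flatten

/-- One step in the construction of a noncrossing partition of `{0, 1, 2, …}`. The stack `s` holds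
the blocks that may still grow, the youngest on top, each list starting with the smallest element of
its block and including the finished blocks that lie between it and the next one; a pair `(z, i)` says that `z` precedes `i` in the cyclic order of the block
of `i`. If `c = 0`, then `i` opens a new block. Otherwise the `c - 1` topmost blocks are finished
and `i` joins the next one. -/
def stackStep (i : ℕ) (c : ℕ) (s : List (List (ℕ × ℕ))) : List (List (ℕ × ℕ)) :=
  match c with
  | 0 => [(i, i)] :: s
  | c + 1 =>
    match s.drop c with
    | ((v, f) :: R) :: rest => ((i, f) :: (R ++ unstack (s.take c) ++ [(v, i)])) :: rest
    | _ => s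

/-- The stack after `n` steps with the parameters `c₀, …, c_{n-1}`. -/
def stack (c : ℕ →₀ ℕ) : ℕ → List (List (ℕ × ℕ))
  | 0 => []
  | n + 1 => stackStep n (c n) (stack c n)

lemma unstack_cons (L : List (ℕ × ℕ)) (s : List (List (ℕ × ℕ))) :
    unstack (L :: s) = unstack s ++ L := by
  simp [unstack]

lemma unstack_append (s t : List (List (ℕ × ℕ))) :
    unstack (s ++ t) = unstack t ++ unstack s := by
  simp [unstack]

lemma pairWord_append {G : Type*} [Group G] (u : ℕ → G) (L M : List (ℕ × ℕ)) :
    pairWord u (L ++ M) = pairWord u L * pairWord u M := by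
  simp [pairWord]

lemma pairWord_cons {G : Type*} [Group G] (u : ℕ → G) (z i : ℕ) (L : List (ℕ × ℕ)) :
    pairWord u ((z, i) :: L) = u z * (u i)⁻¹ * pairWord u L := by
  simp [pairWord]

lemma pairWord_unstack {G : Type*} [Group G] (u : ℕ → G) {s : List (List (ℕ × ℕ))}
    (h : ∀ L ∈ s, pairWord u L = 1) : pairWord u (unstack s) = 1 := by
  induction s with
  | nil => rfl
  | cons L s ih =>
    rw [unstack_cons, pairWord_append, h L List.mem_cons_self,
      ih fun M hM => h M (List.mem_cons_of_mem _ hM), one_mul]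

/-- A step with `c > 0`, described in terms of the decomposition of the stack. -/
lemma exists_stackStep_succ {s : List (List (ℕ × ℕ))} (hs : ∀ L ∈ s, L ≠ []) {c : ℕ}
    (hc : c < s.length) (i : ℕ) : ∃ (t : List (List (ℕ × ℕ))) (v f : ℕ) (R : List (ℕ × ℕ))
      (rest : List (List (ℕ × ℕ))), s = t ++ ((v, f) :: R) :: rest ∧ t.length = c ∧
      stackStep i (c + 1) s = ((i, f) :: (R ++ unstack t ++ [(v, i)])) :: rest := by
  have h0 : s.drop c ≠ [] := fun h => by
    have := List.drop_eq_nil_iff.1 h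
    omega
  obtain ⟨L, rest, hL⟩ := List.exists_cons_of_ne_nil h0
  have hLs : L ∈ s := List.mem_of_mem_drop (hL ▸ List.mem_cons_self)
  obtain ⟨⟨v, f⟩, R, rfl⟩ := List.exists_cons_of_ne_nil (hs L hLs)
  refine ⟨s.take c, v, f, R, rest, ?_, ?_, ?_⟩
  · rw [← hL, List.take_append_drop]
  · rw [List.length_take]; omega
  · simp only [stackStep, hL]

lemma length_stackStep_succ {s : List (List (ℕ × ℕ))} (hs : ∀ L ∈ s, L ≠ []) {c : ℕ}
    (hc : c < s.length) (i : ℕ) : (stackStep i (c + 1) s).length + c = s.length := by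
  obtain ⟨t, v, f, R, rest, rfl, rfl, h⟩ := exists_stackStep_succ hs hc i
  rw [h]
  simp; omega

/-- The parameters `c₀, …, c_{n-1}` never finish more blocks than there are. -/
def Admissible (c : ℕ →₀ ℕ) (n : ℕ) : Prop := ∀ k < n, partialSum c (k + 1) ≤ k

lemma Admissible.of_succ {c : ℕ →₀ ℕ} {n : ℕ} (h : Admissible c (n + 1)) : Admissible c n :=
  fun k hk => h k (by omega)

lemma stack_invariant {c : ℕ →₀ ℕ} {n : ℕ} (h : Admissible c n) :
    (stack c n).length + partialSum c n = n ∧ ∀ L ∈ stack c n, L ≠ [] := by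
  induction n with
  | zero => simp [stack]
  | succ n ih =>
    obtain ⟨hlen, hne⟩ := ih h.of_succ
    have hn := h n (Nat.lt_succ_self n)
    rw [partialSum_succ] at hn ⊢
    rw [stack]
    rcases hc : c n with _ | a
    · refine ⟨by simp [stackStep]; omega, fun L hL => ?_⟩
      rcases List.mem_cons.1 hL with rfl | hL
      · exact List.cons_ne_nil _ _
      · exact hne L hL
    · have ha : a < (stack c n).length := by omega
      refine ⟨by have := length_stackStep_succ hne ha n; omega, ?_⟩
      obtain ⟨t, v, f, R, rest, hs, -, hst⟩ := exists_stackStep_succ hne ha n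
      rw [hst]
      intro L hL
      rcases List.mem_cons.1 hL with rfl | hL
      · exact List.cons_ne_nil _ _
      · exact hne L (by rw [hs]; simp [hL])

lemma pairWord_of_mem_stack {G : Type*} [Group G] (u : ℕ → G) {c : ℕ →₀ ℕ} {n : ℕ}
    (h : Admissible c n) : ∀ L ∈ stack c n, pairWord u L = 1 := by
  induction n with
  | zero => simp [stack]
  | succ n ih =>
    have ih := ih h.of_succ
    obtain ⟨hlen, hne⟩ := stack_invariant h.of_succ
    have hn := h n (Nat.lt_succ_self n)
    rw [partialSum_succ] at hn
    rw [stack]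
    rcases hc : c n with _ | a
    · intro L hL
      rcases List.mem_cons.1 hL with rfl | hL
      · simp [pairWord]
      · exact ih L hL
    · have ha : a < (stack c n).length := by omega
      obtain ⟨t, v, f, R, rest, hs, -, hst⟩ := exists_stackStep_succ hne ha n
      rw [hst]
      rw [hs] at ih
      have hv := ih ((v, f) :: R) (by simp)
      have ht : pairWord u (unstack t) = 1 := pairWord_unstack u fun L hL => ih L (by simp [hL])
      intro L hL
      rcases List.mem_cons.1 hL with rfl | hL
      · -- The old block gives `(u f)⁻¹ * pairWord u R = (u v)⁻¹`.
        rw [pairWord_cons, mul_assoc] at hv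
        rw [pairWord_cons, pairWord_append, pairWord_append, ht, mul_one, mul_assoc,
          ← mul_assoc (u f)⁻¹, eq_inv_of_mul_eq_one_right hv]
        simp [pairWord]
      · exact ih L (by simp [hL])

/-- The pairs `(z, i)` for `i = 0, …, n - 1`, where `z` precedes `i` in its block. -/
def cyclePairs (c : ℕ →₀ ℕ) (n : ℕ) : List (ℕ × ℕ) := unstack (stack c n)

/-- The effect of one step: either `(n, n)` is appended, or the smallest element `f` of some block
is now preceded by `n`, and its former predecessor `v` precedes `n`. -/
lemma cyclePairs_succ {c : ℕ →₀ ℕ} {n : ℕ} (h : Admissible c (n + 1)) :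
    (c n = 0 ∧ cyclePairs c (n + 1) = cyclePairs c n ++ [(n, n)]) ∨
    ∃ (a : ℕ) (t : List (List (ℕ × ℕ))) (v f : ℕ) (R : List (ℕ × ℕ))
      (rest : List (List (ℕ × ℕ))), c n = a + 1 ∧
      stack c n = t ++ ((v, f) :: R) :: rest ∧ t.length = a ∧
      cyclePairs c n = unstack rest ++ (v, f) :: (R ++ unstack t) ∧
      cyclePairs c (n + 1) = unstack rest ++ (n, f) :: (R ++ unstack t) ++ [(v, n)] := by
  obtain ⟨hlen, hne⟩ := stack_invariant h.of_succ
  have hn := h n (Nat.lt_succ_self n)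
  rw [partialSum_succ] at hn
  rcases hc : c n with _ | a
  · left
    refine ⟨rfl, ?_⟩
    rw [cyclePairs, stack, hc, stackStep, unstack_cons]
    rfl
  · right
    have ha : a < (stack c n).length := by omega
    obtain ⟨t, v, f, R, rest, hs, hta, hst⟩ := exists_stackStep_succ hne ha n
    refine ⟨a, t, v, f, R, rest, rfl, hs, hta, ?_, ?_⟩
    · rw [cyclePairs, hs, unstack_append, unstack_cons]; simp
    · rw [cyclePairs, stack, hc, hst, unstack_cons]; simp

lemma cyclePairs_spec {c : ℕ →₀ ℕ} {n : ℕ} (h : Admissible c n) :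
    (cyclePairs c n).map Prod.snd = List.range n ∧ ∀ p ∈ cyclePairs c n, p.1 < n := by
  induction n with
  | zero => simp [cyclePairs, stack, unstack]
  | succ n ih =>
    obtain ⟨h1, h2⟩ := ih h.of_succ
    rw [List.range_succ, ← h1]
    rcases cyclePairs_succ h with ⟨-, he⟩ | ⟨a, t, v, f, R, rest, -, -, -, he, he'⟩
    · rw [he]
      refine ⟨by simp, fun p hp => ?_⟩
      rcases List.mem_append.1 hp with hp | hp
      · exact (h2 p hp).trans (Nat.lt_succ_self n)
      · rw [List.mem_singleton.1 hp]; exact Nat.lt_succ_self n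
    · rw [he] at h2 ⊢
      rw [he']
      refine ⟨by simp, fun p hp => ?_⟩
      have hv := h2 (v, f) (by simp)
      simp only [List.mem_append, List.mem_cons, List.not_mem_nil, or_false] at hp h2
      rcases hp with (hp | rfl | hp) | rfl
      · exact (h2 p (.inl hp)).trans (Nat.lt_succ_self n)
      · exact Nat.lt_succ_self n
      · exact (h2 p (.inr (.inr hp))).trans (Nat.lt_succ_self n)
      · exact Nat.lt_succ_of_lt hv

lemma pairWord_cyclePairs {G : Type*} [Group G] (u : ℕ → G) {c : ℕ →₀ ℕ} {n : ℕ}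
    (h : Admissible c n) : pairWord u (cyclePairs c n) = 1 :=
  pairWord_unstack u (pairWord_of_mem_stack u h)

lemma stack_congr {c c' : ℕ →₀ ℕ} {n : ℕ} (h : ∀ i < n, c i = c' i) : stack c n = stack c' n := by
  induction n with
  | zero => rfl
  | succ n ih => rw [stack, stack, ih fun i hi => h i (by omega), h n (Nat.lt_succ_self n)]

/-- The lengths of the proper final segments of a stack of nonempty lists determine them. -/
lemma length_eq_of_append_eq {t t' rest rest' : List (List (ℕ × ℕ))} {L L' : List (ℕ × ℕ)}
    (h : t ++ L :: rest = t' ++ L' :: rest') (hne : ∀ M ∈ t ++ L :: rest, M ≠ [])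
    (hlen : (unstack rest).length = (unstack rest').length) : t.length = t'.length := by
  induction t generalizing t' with
  | nil =>
    cases t' with
    | nil => rfl
    | cons M t' =>
      exfalso
      obtain ⟨-, rfl⟩ := List.cons.inj h
      have : L' ≠ [] := hne L' (by simp)
      have := List.length_pos_iff.2 this
      simp only [List.append_eq, unstack_append, unstack_cons, List.length_append] at hlen
      omega
  | cons N t ih =>
    cases t' with
    | nil =>
      exfalso
      obtain ⟨-, rfl⟩ := List.cons.inj h
      have : L ≠ [] := hne L (by simp)
      have := List.length_pos_iff.2 this
      simp only [List.append_eq, unstack_append, unstack_cons, List.length_append] at hlen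
      omega
    | cons M t' =>
      obtain ⟨-, h⟩ := List.cons.inj h
      rw [List.length_cons, List.length_cons, ih h fun M hM => hne M (List.mem_cons_of_mem _ hM)]

/-- The cycles determine the parameters. -/
lemma eq_of_cyclePairs_eq {c c' : ℕ →₀ ℕ} {n : ℕ} (h : Admissible c n) (h' : Admissible c' n)
    (he : cyclePairs c n = cyclePairs c' n) : ∀ i < n, c i = c' i := by
  induction n with
  | zero => exact fun i hi => absurd hi (Nat.not_lt_zero i)
  | succ n ih =>
    have hlt := (cyclePairs_spec h.of_succ).2
    have hlt' := (cyclePairs_spec h'.of_succ).2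
    have key : cyclePairs c n = cyclePairs c' n → c n = c' n → ∀ i < n + 1, c i = c' i := by
      intro h1 h2 i hi
      rcases Nat.lt_succ_iff_lt_or_eq.1 hi with hi | rfl
      · exact ih h.of_succ h'.of_succ h1 i hi
      · exact h2
    rcases cyclePairs_succ h with ⟨h0, h1⟩ | ⟨a, t, v, f, R, rest, ha, hs, hta, h1, h2⟩ <;>
    rcases cyclePairs_succ h' with ⟨h0', h1'⟩ | ⟨a', t', v', f', R', rest', ha', hs', hta', h1', h2'⟩
    · rw [h1, h1'] at he
      exact key (List.append_cancel_right he) (h0.trans h0'.symm)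
    · exfalso
      rw [h1, h2'] at he
      have := (List.append_inj' he rfl).2
      have hv := hlt' (v', f') (by rw [h1']; simp)
      simp at this
      simp at hv
      omega
    · exfalso
      rw [h2, h1'] at he
      have := (List.append_inj' he rfl).2
      have hv := hlt (v, f) (by rw [h1]; simp)
      simp at this
      simp at hv
      omega
    · rw [h2, h2'] at he
      obtain ⟨he, hv⟩ := List.append_inj' he rfl
      -- The entry `n` occurs only once as a first component before the last pair.
      have hl : (unstack rest).length = (unstack rest').length := by
        have hnot : ∀ p ∈ unstack rest, p.1 ≠ n := fun p hp =>
          (hlt p (by rw [h1]; simp [hp])).ne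
        have hnot' : ∀ p ∈ unstack rest', p.1 ≠ n := fun p hp =>
          (hlt' p (by rw [h1']; simp [hp])).ne
        have e1 : ((unstack rest ++ (n, f) :: (R ++ unstack t)).takeWhile (fun p => p.1 ≠ n)) =
            unstack rest := by
          rw [List.takeWhile_append_of_pos (by simpa using hnot)]; simp
        have e2 : ((unstack rest' ++ (n, f') :: (R' ++ unstack t')).takeWhile (fun p => p.1 ≠ n)) =
            unstack rest' := by
          rw [List.takeWhile_append_of_pos (by simpa using hnot')]; simp
        rw [← e1, he, e2]
      obtain ⟨hr, hc⟩ := List.append_inj he hl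
      obtain ⟨hf, hR⟩ := List.cons.inj hc
      have hcp : cyclePairs c n = cyclePairs c' n := by
        simp only [List.cons.injEq, Prod.mk.injEq, and_true, true_and] at hv hf
        rw [h1, h1', hr, hR, hf, hv]
      refine key hcp ?_
      have hst := stack_congr (ih h.of_succ h'.of_succ hcp)
      rw [hs, hs'] at hst
      rw [ha, ha', ← hta, ← hta', length_eq_of_append_eq hst
        (hs ▸ (stack_invariant h.of_succ).2) hl]

/-! ### The degree filtration -/

section Filtration

variable {A : Type*} [CommRing A] [Algebra ℚ A]

/-- The span of the values at `(X₀, …, X_{n-1})` of the monomials of degree less than `d`. -/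
def degreeFiltration (n : ℕ) (X : ℕ → A) (d : ℕ) : Submodule ℚ A :=
  Submodule.span ℚ {y | ∃ m : ℕ →₀ ℕ, m.degree < d ∧ (∀ i, n ≤ i → m i = 0) ∧
    y = monomialValue n X m}

variable {n : ℕ} {X : ℕ → A}

lemma monomialValue_mem_degreeFiltration {m : ℕ →₀ ℕ} {d : ℕ} (hd : m.degree < d)
    (hm : ∀ i, n ≤ i → m i = 0) : monomialValue n X m ∈ degreeFiltration n X d :=
  Submodule.subset_span ⟨m, hd, hm, rfl⟩

lemma degreeFiltration_mono {d d' : ℕ} (h : d ≤ d') :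
    degreeFiltration n X d ≤ degreeFiltration n X d' :=
  Submodule.span_mono fun _ ⟨m, hd, hm, hy⟩ => ⟨m, hd.trans_le h, hm, hy⟩

lemma mul_mem_degreeFiltration {i j : ℕ} {x y : A} (hx : x ∈ degreeFiltration n X (i + 1))
    (hy : y ∈ degreeFiltration n X j) : x * y ∈ degreeFiltration n X (i + j) := by
  have h := Submodule.mul_mem_mul hx hy
  rw [degreeFiltration, degreeFiltration, Submodule.span_mul_span] at h
  refine Submodule.span_mono ?_ h
  rintro _ ⟨_, ⟨m, hd, hm, rfl⟩, _, ⟨m', hd', hm', rfl⟩, rfl⟩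
  refine ⟨m + m', by rw [map_add]; omega, fun k hk => ?_, (monomialValue_add n X m m').symm⟩
  simp [hm k hk, hm' k hk]

lemma variable_mul_mem_degreeFiltration {i d : ℕ} (hi : i < n) {y : A}
    (hy : y ∈ degreeFiltration n X d) : X i * y ∈ degreeFiltration n X (d + 1) := by
  rw [add_comm]
  refine mul_mem_degreeFiltration ?_ hy
  rw [← monomialValue_single X hi]
  refine monomialValue_mem_degreeFiltration (by simp) fun k hk => ?_
  have : i ≠ k := by omega
  simp [this]

lemma natCast_mul_mem_degreeFiltration {d : ℕ} (q : ℕ) {y : A}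
    (hy : y ∈ degreeFiltration n X d) : (q : A) * y ∈ degreeFiltration n X d := by
  rw [← nsmul_eq_mul]
  exact nsmul_mem hy q

lemma addLetter_mem_degreeFiltration {i : ℕ} (hi : i < n) {φ : List ℕ → A} {s : ℕ}
    (hφ : ∀ l, φ l ∈ degreeFiltration n X ((parts l).sum + s)) (l : List ℕ) :
    addLetter (X i) φ l ∈ degreeFiltration n X ((parts l).sum + s) := by
  cases l with
  | nil => rw [addLetter]; exact hφ []
  | cons a l =>
    induction a with
    | zero =>
      rw [addLetter]
      refine add_mem (hφ _) ?_
      have := variable_mul_mem_degreeFiltration hi (hφ l)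
      rwa [show (parts l).sum + s + 1 = (parts (0 :: l)).sum + s by simp; omega] at this
    | succ a ih =>
      rw [addLetter]
      refine add_mem (hφ _) ?_
      have := variable_mul_mem_degreeFiltration hi ih
      rwa [show (parts (a :: l)).sum + s + 1 = (parts ((a + 1) :: l)).sum + s by
        simp; omega] at this

/-- Removing a constant variable changes value functions only by terms of lower degree. -/
lemma removeLetter_sub_mem_degreeFiltration (q : ℕ) {φ : List ℕ → A}
    (hφ : ∀ l, φ l ∈ degreeFiltration n X ((parts l).sum + 1)) (l : List ℕ) :
    removeLetter (q : A) φ l - φ l ∈ degreeFiltration n X (parts l).sum := by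
  induction l with
  | nil => rw [removeLetter, sub_self]; exact zero_mem _
  | cons a l ih =>
    cases a with
    | zero =>
      rw [removeLetter, sub_sub_cancel_left]
      have h : removeLetter (q : A) φ l ∈ degreeFiltration n X ((parts l).sum + 1) := by
        have := add_mem (degreeFiltration_mono (Nat.le_succ _) ih) (hφ l)
        rwa [sub_add_cancel] at this
      have := neg_mem (natCast_mul_mem_degreeFiltration q h)
      rwa [show (parts l).sum + 1 = (parts (0 :: l)).sum by simp; omega] at this
    | succ a =>
      rw [removeLetter, sub_sub_cancel_left]
      have := neg_mem (natCast_mul_mem_degreeFiltration q (hφ (a :: l)))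
      rwa [show (parts (a :: l)).sum + 1 = (parts ((a + 1) :: l)).sum by simp; omega] at this

lemma noLetter_mem_degreeFiltration (l : List ℕ) :
    noLetter l ∈ degreeFiltration n X ((parts l).sum + 1) := by
  cases l with
  | nil =>
    rw [noLetter, ← monomialValue_zero n X]
    exact monomialValue_mem_degreeFiltration (by simp) fun _ _ => rfl
  | cons a l => exact zero_mem _

lemma foldr_letters_mem_degreeFiltration (is : List ℕ) (his : ∀ i ∈ is, i < n) :
    (∀ l, is.foldr (fun i φ => addLetter (X i) (removeLetter (i : A) φ)) noLetter l ∈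
      degreeFiltration n X ((parts l).sum + 1)) ∧
    ∀ l, is.foldr (fun i φ => addLetter (X i) (removeLetter (i : A) φ)) noLetter l -
        is.foldr (fun i φ => addLetter (X i) φ) noLetter l ∈
      degreeFiltration n X (parts l).sum := by
  induction is with
  | nil => exact ⟨noLetter_mem_degreeFiltration, fun l => by simp⟩
  | cons i is ih =>
    obtain ⟨h1, h2⟩ := ih fun j hj => his j (List.mem_cons_of_mem _ hj)
    have hi := his i List.mem_cons_self
    have h3 := removeLetter_sub_mem_degreeFiltration (X := X) i h1
    rw [List.foldr_cons, List.foldr_cons]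
    refine ⟨addLetter_mem_degreeFiltration hi fun l => ?_, fun l => ?_⟩
    · have := add_mem (degreeFiltration_mono (Nat.le_succ _) (h3 l)) (h1 l)
      rwa [sub_add_cancel] at this
    · rw [← addLetter_sub]
      refine addLetter_mem_degreeFiltration (s := 0) hi (fun l => ?_) l
      have := add_mem (h3 l) (h2 l)
      rwa [sub_add_sub_cancel] at this

/-- If adding the variables `X₀, …, X_{n-1}` and removing the constants `0, …, n - 1`, in
alternation, has no effect, then the elements of the ideal of quasi-symmetric functions take values
of smaller degree than expected. -/
lemma componentValue_mem_degreeFiltration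
    (h : (List.range n).foldr (fun i φ => addLetter (X i) (removeLetter (i : A) φ)) noLetter =
      noLetter) {f : QSeries} (hf : f ∈ (levelIdeal 0).closure) (d : ℕ) :
    componentValue n d X f ∈ degreeFiltration n X d := by
  obtain ⟨g, hg, hgf⟩ := mem_closure_iff_forall_finset.1 hf (exponents n d)
  have : componentValue n d X f = componentValue n d X g := by
    rw [componentValue_apply, componentValue_apply]
    exact Finset.sum_congr rfl fun m hm => by rw [hgf m hm]
  rw [this]
  clear this hgf hf
  rw [levelIdeal_eq_span] at hg
  induction hg using Submodule.span_induction generalizing d with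
  | mem g hg =>
    obtain ⟨l, hl, -, rfl⟩ := hg
    by_cases hd : d = (parts l).sum
    · subst hd
      rw [componentValue_listFundamental]
      have := (foldr_letters_mem_degreeFiltration (X := X) (List.range n)
        fun i hi => List.mem_range.1 hi).2 l
      rw [h] at this
      obtain ⟨a, l, rfl⟩ := List.exists_cons_of_ne_nil hl
      simpa [noLetter] using this
    · rw [componentValue_listFundamental_of_ne X hd]
      exact zero_mem _
  | zero => rw [map_zero]; exact zero_mem _
  | add g g' _ _ h1 h2 => rw [map_add]; exact add_mem (h1 d) (h2 d)
  | smul c g _ h1 =>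
    rw [smul_eq_mul, componentValue_mul]
    refine sum_mem fun p hp => ?_
    rw [← Finset.HasAntidiagonal.mem_antidiagonal.1 hp]
    refine mul_mem_degreeFiltration ?_ (h1 p.2)
    rw [componentValue_apply]
    refine sum_mem fun m hm => Submodule.smul_mem _ _ ?_
    obtain ⟨hd, hs⟩ := mem_exponents.1 hm
    exact monomialValue_mem_degreeFiltration (by omega) hs

end Filtration

/-! ### Interpolation at the points -/

/-- The exponent sequences of type `0`-Catalan that involve the first `n` variables only. -/
abbrev CatalanExponents (n : ℕ) : Type :=
  {c : ℕ →₀ ℕ // IsECatalan 0 c ∧ ∀ i, n ≤ i → c i = 0}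

lemma CatalanExponents.admissible {n : ℕ} (c : CatalanExponents n) : Admissible c.1 n :=
  fun k _ => (isECatalan_iff 0 c.1).1 c.2.1 k

instance CatalanExponents.finite (n : ℕ) : Finite (CatalanExponents n) := by
  classical
  refine Set.Finite.subset ((Finset.range (n + 1)).biUnion fun d => exponents n d).finite_toSet ?_
  rintro c ⟨hc, hn⟩
  rw [Finset.mem_coe, Finset.mem_biUnion]
  refine ⟨c.degree, ?_, mem_exponents.2 ⟨rfl, hn⟩⟩
  obtain ⟨k, hk⟩ := exists_partialSum_eq_degree c
  have : ∀ j, partialSum c (n + j) = partialSum c n := fun j => by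
    induction j with
    | zero => rfl
    | succ j ih => rw [← add_assoc, partialSum_succ, ih, hn _ (by omega), add_zero]
  have h1 := partialSum_mono c (Nat.le_add_left k n)
  have h2 := partialSum_mono c (Nat.le_succ n)
  have h3 := (isECatalan_iff 0 c).1 hc n
  rw [Finset.mem_range]
  rw [this] at h1
  simp at h2
  omega

/-- The `i`-th coordinate of the point of the exponent sequence `c`: the element that precedes `i`
in its block. -/
def predecessor (c : ℕ →₀ ℕ) (n i : ℕ) : ℕ := ((cyclePairs c n).map Prod.fst).getD i 0

lemma cyclePairs_eq_map {c : ℕ →₀ ℕ} {n : ℕ} (h : Admissible c n) :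
    cyclePairs c n = (List.range n).map fun i => (predecessor c n i, i) := by
  have hs := (cyclePairs_spec h).1
  have hl : (cyclePairs c n).length = n := by
    rw [← List.length_map Prod.snd, hs, List.length_range]
  refine List.ext_getElem (by simp [hl]) fun i h1 h2 => ?_
  have h3 : ((cyclePairs c n).map Prod.snd)[i]'(by simpa using h1) = i := by simp [hs]
  rw [List.getElem_map] at h3
  rw [List.getElem_map, List.getElem_range]
  refine Prod.ext ?_ h3
  rw [predecessor, List.getD_eq_getElem _ _ (by simpa using h1), List.getElem_map]

/-- The coordinate functions on the set of points, which is indexed by the exponent sequences. -/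
def coordinate (n i : ℕ) : CatalanExponents n → ℚ := fun c => (predecessor c.1 n i : ℚ)

lemma exists_coordinate_ne {n : ℕ} {c c' : CatalanExponents n} (h : c ≠ c') :
    ∃ i < n, coordinate n i c ≠ coordinate n i c' := by
  by_contra! hne
  refine h (Subtype.ext (Finsupp.ext fun i => ?_))
  rcases lt_or_ge i n with hi | hi
  · refine eq_of_cyclePairs_eq c.admissible c'.admissible ?_ i hi
    rw [cyclePairs_eq_map c.admissible, cyclePairs_eq_map c'.admissible]
    refine List.map_congr_left fun j hj => ?_
    have : predecessor c.1 n j = predecessor c'.1 n j :=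
      Nat.cast_injective (R := ℚ) (hne j (List.mem_range.1 hj))
    rw [this]
  · rw [c.2.2 i hi, c'.2.2 i hi]

lemma foldr_letters_eq_prod (z : ℕ → ℕ) (is : List ℕ) (φ : List ℕ → ℚ) :
    is.foldr (fun i φ => addLetter (z i : ℚ) (removeLetter (i : ℚ) φ)) φ =
      (is.map fun i => letterPerm (z i : ℚ) * (letterPerm (i : ℚ))⁻¹).prod φ := by
  induction is with
  | nil => rfl
  | cons i is ih =>
    rw [List.foldr_cons, ih, List.map_cons, List.prod_cons]
    rfl

lemma foldr_letters_apply (n : ℕ) (c : CatalanExponents n) (is : List ℕ) (l : List ℕ) :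
    is.foldr (fun i φ => addLetter (coordinate n i)
      (removeLetter (i : CatalanExponents n → ℚ) φ)) noLetter l c =
    is.foldr (fun i φ => addLetter (predecessor c.1 n i : ℚ) (removeLetter (i : ℚ) φ))
      noLetter l := by
  induction is generalizing l with
  | nil => exact map_noLetter (Pi.evalRingHom (fun _ => ℚ) c) l
  | cons i is ih =>
    rw [List.foldr_cons, List.foldr_cons, ← funext ih]
    refine (map_addLetter (Pi.evalRingHom (fun _ => ℚ) c) _ _ l).trans ?_
    congr 1
    funext l'
    exact map_removeLetter (Pi.evalRingHom (fun _ => ℚ) c) _ _ l'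

lemma foldr_letters_coordinate (n : ℕ) :
    (List.range n).foldr (fun i φ => addLetter (coordinate n i)
      (removeLetter (i : CatalanExponents n → ℚ) φ)) noLetter = noLetter := by
  funext l c
  rw [foldr_letters_apply, foldr_letters_eq_prod]
  have := pairWord_cyclePairs (fun i => letterPerm (i : ℚ)) c.admissible
  rw [cyclePairs_eq_map c.admissible, pairWord, List.map_map] at this
  refine (congrFun (DFunLike.congr_fun this noLetter) l).trans ?_
  exact (map_noLetter (Pi.evalRingHom (fun _ => ℚ) c) l).symm

/-- Every function on the set of points is a polynomial in the coordinates. -/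
lemma exists_mem_degreeFiltration (n : ℕ) (y : CatalanExponents n → ℚ) :
    ∃ d, y ∈ degreeFiltration n (coordinate n) d := by
  classical
  have := Fintype.ofFinite (CatalanExponents n)
  have hdelta : ∀ (c : CatalanExponents n) (s : Finset (CatalanExponents n)), c ∉ s →
      ∃ d, ∃ e ∈ degreeFiltration n (coordinate n) d, e c ≠ 0 ∧ ∀ c' ∈ s, e c' = 0 := by
    intro c s
    induction s using Finset.induction_on with
    | empty =>
      intro _
      refine ⟨1, 1, ?_, one_ne_zero, by simp⟩
      rw [← monomialValue_zero n (coordinate n)]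
      exact monomialValue_mem_degreeFiltration (by simp) fun _ _ => rfl
    | insert c' s _ ih =>
      intro hc
      rw [Finset.mem_insert, not_or] at hc
      obtain ⟨d, e, he, hec, hes⟩ := ih hc.2
      obtain ⟨i, hi, hne⟩ := exists_coordinate_ne hc.1
      refine ⟨d + 1, coordinate n i * e - coordinate n i c' • e,
        sub_mem (variable_mul_mem_degreeFiltration hi he)
          (Submodule.smul_mem _ _ (degreeFiltration_mono (Nat.le_succ d) he)), ?_, ?_⟩
      · rw [Pi.sub_apply, Pi.mul_apply, Pi.smul_apply, smul_eq_mul, ← sub_mul]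
        exact mul_ne_zero (sub_ne_zero.2 hne) hec
      · intro b hb
        rw [Pi.sub_apply, Pi.mul_apply, Pi.smul_apply, smul_eq_mul, ← sub_mul]
        rcases Finset.mem_insert.1 hb with rfl | hb
        · rw [sub_self, zero_mul]
        · rw [hes b hb, mul_zero]
  have hsingle : ∀ c : CatalanExponents n, ∃ d,
      (Pi.single c 1 : CatalanExponents n → ℚ) ∈ degreeFiltration n (coordinate n) d := by
    intro c
    obtain ⟨d, e, he, hec, hes⟩ := hdelta c (Finset.univ.erase c) (Finset.notMem_erase _ _)
    refine ⟨d, ?_⟩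
    have : (Pi.single c 1 : CatalanExponents n → ℚ) = (e c)⁻¹ • e := by
      funext b
      rcases eq_or_ne b c with rfl | hb
      · simp [hec]
      · simp [hb, hes b (Finset.mem_erase.2 ⟨hb, Finset.mem_univ b⟩)]
    rw [this]
    exact Submodule.smul_mem _ _ he
  choose d hd using hsingle
  refine ⟨Finset.univ.sup d, ?_⟩
  rw [pi_eq_sum_univ' y]
  refine sum_mem fun c _ => Submodule.smul_mem _ _ ?_
  have := degreeFiltration_mono (Finset.le_sup (Finset.mem_univ c)) (hd c)
  convert this using 1

/-- The function on the set of points given by the monomial `c`. -/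
def catalanValue (n : ℕ) (c : CatalanExponents n) : CatalanExponents n → ℚ :=
  monomialValue n (coordinate n) c.1

lemma degreeFiltration_le_span (n d : ℕ) : degreeFiltration n (coordinate n) d ≤
    Submodule.span ℚ (catalanValue n '' {c | c.1.degree < d}) := by
  classical
  induction d with
  | zero =>
    refine Submodule.span_le.2 ?_
    rintro _ ⟨m, hd, -⟩
    exact absurd hd (Nat.not_lt_zero _)
  | succ d ih =>
    have hle : Submodule.span ℚ (catalanValue n '' {c | c.1.degree < d}) ≤
        Submodule.span ℚ (catalanValue n '' {c | c.1.degree < d + 1}) :=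
      Submodule.span_mono (Set.image_mono fun c hc => Nat.lt_succ_of_lt hc)
    refine Submodule.span_le.2 ?_
    rintro _ ⟨m, hd, hm, rfl⟩
    rcases Nat.lt_succ_iff_lt_or_eq.1 hd with hd | rfl
    · exact hle (ih (monomialValue_mem_degreeFiltration hd hm))
    -- Modulo the ideal, the monomial `m` is a combination of Catalan monomials of the same degree.
    obtain ⟨g, hg, hgI⟩ := exists_sub_mem_closure (S := {c | IsECatalan 0 c})
      (fun ε hε => exists_hasLeading_mem_levelIdeal hε) (MvPowerSeries.monomial m 1)
    have h1 := ih (componentValue_mem_degreeFiltration (foldr_letters_coordinate n) hgI m.degree)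
    have h2 : componentValue n m.degree (coordinate n) (MvPowerSeries.monomial m 1) =
        monomialValue n (coordinate n) m := by
      rw [componentValue_apply, Finset.sum_eq_single m]
      · rw [MvPowerSeries.coeff_monomial_same, one_smul]
      · intro b _ hb
        rw [MvPowerSeries.coeff_monomial, if_neg hb, zero_smul]
      · exact fun h => absurd (mem_exponents.2 ⟨rfl, hm⟩) h
    have h3 : componentValue n m.degree (coordinate n) g ∈
        Submodule.span ℚ (catalanValue n '' {c | c.1.degree < m.degree + 1}) := by
      rw [componentValue_apply]
      refine sum_mem fun b hb => ?_
      obtain ⟨hbd, hbn⟩ := mem_exponents.1 hb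
      by_cases hbc : IsECatalan 0 b
      · exact Submodule.smul_mem _ _ (Submodule.subset_span
          ⟨⟨b, hbc, hbn⟩, by simp [hbd], rfl⟩)
      · rw [hg b hbc, zero_smul]
        exact zero_mem _
    rw [map_sub, h2] at h1
    have := add_mem (hle h1) h3
    rwa [sub_add_cancel] at this

/-- The Catalan monomials are linearly independent on the set of points: they span the space of
functions, and there are as many of them as points. -/
lemma linearIndependent_catalanValue (n : ℕ) : LinearIndependent ℚ (catalanValue n) := by
  have := Fintype.ofFinite (CatalanExponents n)
  refine linearIndependent_of_top_le_span_of_card_eq_finrank (fun y _ => ?_) (by simp)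
  obtain ⟨d, hd⟩ := exists_mem_degreeFiltration n y
  exact Submodule.span_mono (Set.image_subset_range _ _) (degreeFiltration_le_span n d hd)

/-- No nonzero series supported on the monomials of type `0`-Catalan lies in the closure of the
ideal of quasi-symmetric functions. -/
lemma eq_zero_of_mem_closure_levelIdeal_zero {f : QSeries} (hf : f ∈ (levelIdeal 0).closure)
    (hc : ∀ m, ¬ IsECatalan 0 m → MvPowerSeries.coeff m f = 0) : f = 0 := by
  classical
  ext m
  rw [map_zero]
  by_cases hm : IsECatalan 0 m
  swap
  · exact hc m hm
  obtain ⟨n, hn⟩ : ∃ n, ∀ i, n ≤ i → m i = 0 := by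
    refine ⟨m.support.sup id + 1, fun i hi => ?_⟩
    by_contra h
    have : id i ≤ m.support.sup id := Finset.le_sup (Finsupp.mem_support_iff.2 h)
    simp at this
    omega
  have := Fintype.ofFinite (CatalanExponents n)
  have hLI := linearIndependent_catalanValue n
  set d := m.degree with hd
  have h1 := degreeFiltration_le_span n d
    (componentValue_mem_degreeFiltration (foldr_letters_coordinate n) hf d)
  have h2 : componentValue n d (coordinate n) f = ∑ c : CatalanExponents n,
      (if c.1.degree = d then MvPowerSeries.coeff c.1 f else 0) • catalanValue n c := by
    simp only [ite_smul, zero_smul]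
    rw [← Finset.sum_filter, componentValue_apply]
    symm
    refine Finset.sum_of_injOn Subtype.val Subtype.val_injective.injOn ?_ ?_ fun c _ => rfl
    · intro c hc
      exact mem_exponents.2 ⟨by simpa using hc, c.2.2⟩
    · intro b hb hbc
      obtain ⟨hbd, hbn⟩ := mem_exponents.1 hb
      rw [hc b, zero_smul]
      exact fun h => hbc ⟨⟨b, h, hbn⟩, by simp [hbd], rfl⟩
  have h3 : componentValue n d (coordinate n) f ∈
      Submodule.span ℚ (catalanValue n '' {c | c.1.degree = d}) := by
    rw [h2]
    refine sum_mem fun c _ => ?_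
    split_ifs with h
    · exact Submodule.smul_mem _ _ (Submodule.subset_span ⟨c, h, rfl⟩)
    · rw [zero_smul]; exact zero_mem _
  have hdisj : Disjoint {c : CatalanExponents n | c.1.degree = d} {c | c.1.degree < d} :=
    Set.disjoint_left.2 fun c h h' => by simp at h h'; omega
  have h4 := Submodule.disjoint_def.1 (hLI.disjoint_span_image hdisj) _ h3 h1
  rw [h2] at h4
  have := Fintype.linearIndependent_iff.1 hLI _ h4 ⟨m, hm, hn⟩
  simpa [← hd] using this

/-! ### The Hilbert basis -/

lemma shiftSeries_mem_closure {e : ℕ} {f : QSeries} (hf : f ∈ (levelIdeal (e + 1)).closure) :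
    shiftSeries f ∈ (levelIdeal e).closure := by
  classical
  rw [mem_closure_iff_forall_finset] at hf ⊢
  intro T
  obtain ⟨g, hg, hgf⟩ := hf (T.image tailExp)
  refine ⟨shiftSeries g, shiftSeries_mem_levelIdeal hg, fun m hm => ?_⟩
  rw [coeff_shiftSeries, coeff_shiftSeries, hgf _ (Finset.mem_image_of_mem _ hm)]

lemma isECatalan_of_tailExp {e : ℕ} {m : ℕ →₀ ℕ} (h0 : m 0 = 0)
    (h : IsECatalan (e + 1) (tailExp m)) : IsECatalan e m := by
  rw [isECatalan_iff] at h ⊢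
  intro k
  rw [partialSum_succ', h0, zero_add]
  cases k with
  | zero => simp
  | succ k => have := h k; omega

/-- No nonzero series supported on the monomials of type `e`-Catalan lies in the closure of the
ideal of level `e`. The shift reduces the claim to the case `e = 0`. -/
lemma eq_zero_of_mem_closure_levelIdeal {e : ℕ} {f : QSeries}
    (hf : f ∈ (levelIdeal e).closure)
    (hc : ∀ m, ¬ IsECatalan e m → MvPowerSeries.coeff m f = 0) : f = 0 := by
  induction e generalizing f with
  | zero => exact eq_zero_of_mem_closure_levelIdeal_zero hf hc
  | succ e ih =>
    have h : shiftSeries f = 0 := by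
      refine ih (shiftSeries_mem_closure hf) fun m hm => ?_
      rw [coeff_shiftSeries]
      split_ifs with h0
      · exact hc _ fun h => hm (isECatalan_of_tailExp h0 h)
      · rfl
    exact MvPowerSeries.rename_injective succEmb (h.trans (map_zero shiftSeries).symm)

open Classical in
/-- The series with the given coefficients at the monomials of type `e`-Catalan. -/
noncomputable def catalanSeries {e : ℕ} (c : {a : ℕ →₀ ℕ // IsECatalan e a} → ℚ) : QSeries :=
  fun m => if h : IsECatalan e m then c ⟨m, h⟩ else 0

lemma coeff_catalanSeries {e : ℕ} (c : {a : ℕ →₀ ℕ // IsECatalan e a} → ℚ)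
    (a : {a : ℕ →₀ ℕ // IsECatalan e a}) :
    MvPowerSeries.coeff a.1 (catalanSeries c) = c a := by
  change catalanSeries c a.1 = c a
  rw [catalanSeries, dif_pos a.2]

lemma coeff_catalanSeries_eq_zero {e : ℕ} (c : {a : ℕ →₀ ℕ // IsECatalan e a} → ℚ)
    {m : ℕ →₀ ℕ} (h : ¬ IsECatalan e m) : MvPowerSeries.coeff m (catalanSeries c) = 0 := by
  change catalanSeries c m = 0
  rw [catalanSeries, dif_neg h]

lemma hasSum_catalanSeries {e : ℕ} (c : {a : ℕ →₀ ℕ // IsECatalan e a} → ℚ) :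
    HasSum (fun a => c a • (MvPowerSeries.monomial a.1 1 : QSeries)) (catalanSeries c) := by
  classical
  let _ : TopologicalSpace ℚ := ⊥
  refine Pi.hasSum.2 fun m => ?_
  have hcoeff : ∀ a : {a : ℕ →₀ ℕ // IsECatalan e a},
      (c a • (MvPowerSeries.monomial a.1 1 : QSeries)) m = if m = a.1 then c a else 0 := by
    intro a
    change c a * MvPowerSeries.coeff m (MvPowerSeries.monomial a.1 1) = _
    rw [MvPowerSeries.coeff_monomial, mul_ite, mul_one, mul_zero]
  simp only [hcoeff]
  by_cases h : IsECatalan e m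
  · have hs : catalanSeries c m =
        if m = (⟨m, h⟩ : {a // IsECatalan e a}).1 then c ⟨m, h⟩ else 0 := by
      rw [if_pos rfl]
      exact coeff_catalanSeries c ⟨m, h⟩
    rw [hs]
    exact hasSum_single (f := fun a : {a // IsECatalan e a} => if m = a.1 then c a else 0)
      ⟨m, h⟩ fun a ha => if_neg fun hm => ha (Subtype.ext hm.symm)
  · have hs : catalanSeries c m = 0 := coeff_catalanSeries_eq_zero c h
    rw [hs]
    convert hasSum_zero using 2 with a
    refine if_neg fun hm => h ?_
    rw [hm]
    exact a.2

theorem corollary5p6 :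
    (∀ e : ℕ, IsHilbertBasis (fun a : {a : ℕ →₀ ℕ // IsECatalan e a} =>
      (Ideal.Quotient.mk (levelIdeal e).closure (MvPowerSeries.monomial a.1 1) :
        LevelQuotient e))) ∧
    levelIdeal 0 = qsymIdeal := by
  classical
  refine ⟨fun e v => ?_, levelIdeal_zero_eq⟩
  have hclosed : IsClosed ((levelIdeal e).closure : Set QSeries) := by
    rw [Ideal.coe_closure]
    exact isClosed_closure
  have : IsClosed ((levelIdeal e).closure.toAddSubgroup : Set QSeries) := hclosed
  have hT : T3Space (LevelQuotient e) :=
    QuotientAddGroup.instT3Space (levelIdeal e).closure.toAddSubgroup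
  have hsum : ∀ c : {a : ℕ →₀ ℕ // IsECatalan e a} → ℚ,
      HasSum (fun a => c a • (Ideal.Quotient.mk (levelIdeal e).closure
        (MvPowerSeries.monomial a.1 1) : LevelQuotient e))
        (Ideal.Quotient.mk (levelIdeal e).closure (catalanSeries c)) := fun c =>
    (hasSum_catalanSeries c).map (Ideal.Quotient.mk (levelIdeal e).closure) continuous_quot_mk
  obtain ⟨f, rfl⟩ := Ideal.Quotient.mk_surjective v
  obtain ⟨g, hg, hfg⟩ := exists_sub_mem_closure (S := {a | IsECatalan e a})
    (fun ε hε => exists_hasLeading_mem_levelIdeal hε) f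
  have hgc : g = catalanSeries fun a : {a // IsECatalan e a} => MvPowerSeries.coeff a.1 g := by
    ext m
    by_cases h : IsECatalan e m
    · exact (coeff_catalanSeries (fun a => MvPowerSeries.coeff a.1 g) ⟨m, h⟩).symm
    · exact (hg m h).trans (coeff_catalanSeries_eq_zero _ h).symm
  have hmk : Ideal.Quotient.mk (levelIdeal e).closure f =
      Ideal.Quotient.mk (levelIdeal e).closure g := Ideal.Quotient.eq.2 hfg
  refine ⟨fun a => MvPowerSeries.coeff a.1 g, ?_, fun c hc => ?_⟩
  · have := hsum fun a => MvPowerSeries.coeff a.1 g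
    rwa [← hgc, ← hmk] at this
  · have h1 := (hsum c).unique hc
    rw [hmk] at h1
    have h2 : catalanSeries c - g = 0 := by
      refine eq_zero_of_mem_closure_levelIdeal (Ideal.Quotient.eq.1 h1) fun m hm => ?_
      rw [map_sub, hg m hm, sub_zero]
      exact coeff_catalanSeries_eq_zero c hm
    funext a
    rw [← sub_eq_zero.1 h2, coeff_catalanSeries]
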